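/- Let $b\ge 2$ and let $\mathbb V$ be the vertex set of the rooted tree in which every vertex has $b$ children; let $\mathbb V_n$ be the set of vertices at distance $n$ from the root. Let $\bar\xi_{ij}$, $1\le i,j\le b$, be positive random variables. Give the root any fixed colour in $\{1,\dots,b\}$ and colour $\mathbb V_1,\mathbb V_2,\dots$ recursively at random: given the colours of $\mathbb V_0,\dots,\mathbb V_{n-1}$, the colouring of $\mathbb V_n$ is uniform over the $(b!)^{b^{n-1}}$ colourings with colours in $\{1,\dots,b\}$ in which siblings have different colours. Write $c(v)$ for the colour of $v$. Assign to each edge $(u,v)$, $u$ being the parent of $v$, a random label $\zeta_{uv}$ such that, conditionally on the colouring, $\zeta_{uv}$ has the law of $\bar\xi_{c(u)c(v)}$, and the labels of any finitely many edges with pairwise distinct parent endpoints are independent (labels of sibling edges may be dependent). Let $\zeta[v]$ be the product of the labels on the path from the root to $v$ (so $\zeta[v]=1$ for the root), and for $x>0$ let $Z(x)$ be the number of vertices $v$ with $\zeta[v]>x$. Let $\mathbb D=\{s\in\mathbb R:\ \mathbb E\,\bar\xi_{ij}^{\,s}<\infty\ \text{for all } i,j\}$. For $s\ge 0$ let $\rho(s)$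 be the largest eigenvalue of the matrix $(\mathbb E\,\bar\xi_{ij}^{\,s})_{i,j=1}^b$ if $s\in\mathbb D$, and $\rho(s)=+\infty$ if $s\notin\mathbb D$. Let $\lambda=\inf_{s\ge 0}\rho(s)$. Suppose that $[0,1]\subseteq\mathbb D$, that $0$ is an interior point of $\mathbb D$, and that $\mathbb E|\log\bar\xi_{ij}|<\infty$ and $\mathbb E|\bar\xi_{ij}\log\bar\xi_{ij}|<\infty$ for all $i,j$. (a) If $\lambda<1$, then for every $x>0$, $Z(x)<\infty$ almost surely. (b) If $\lambda>1$ and the products $\zeta[v]$ are not all almost surely bounded by one common constant (that is, for every $C$ there is a vertex $v$ with $\mathbb P(\zeta[v]>C)>0$), then for every $x>0$, $Z(x)=\infty$ almost surely. -/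

import Mathlib

open MeasureTheory

noncomputable section

namespace ColouredTree

/-- The vertices of the `b`-ary rooted tree: finite words over `Fin b`. The root is `[]`, the `b`
children of `v` are the words `i :: v`, and the level of `v` is `v.length`. -/
abbrev Vertex (b : ℕ) : Type := List (Fin b)

/-- A colouring of the vertices in which siblings have different colours. -/
def IsProper {b : ℕ} (κ : Vertex b → Fin b) : Prop :=
  ∀ v : Vertex b, Function.Injective fun i : Fin b => κ (i :: v)

/-- The event that the random colouring `c` agrees with `κ` on the levels `0, …, n`. -/
def agreeUpTo {b : ℕ} {Ω : Type*} (c : Ω → Vertex b → Fin b) (κ : Vertex b → Fin b) (n : ℕ) :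
    Set Ω :=
  {ω | ∀ v : Vertex b, v.length ≤ n → c ω v = κ v}

/-- `ξ i j`, `i, j : Fin b`, are the positive reference variables (on a probability space
`(Ω', P')`), `c` is the random colouring, and `ζ v i` is the label of the edge from the vertex `v`
to its child `i :: v`. The root has colour `α`; given the colours of the levels `0, …, n`, the
colouring of level `n + 1` is uniform over the `(b !) ^ (b ^ n)` colourings in which siblings have
different colours; conditionally on the whole colouring, an edge from `u` to `v` has the law of
`ξ (c u) (c v)`, and labels of finitely many edges whose parent endpoints are pairwise distinct are
independent. Nothing is assumed on the dependence between sibling edges. -/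
structure IsRandomEnvironment {b : ℕ} {Ω Ω' : Type*} [MeasurableSpace Ω] [MeasurableSpace Ω']
    (P : Measure Ω) (P' : Measure Ω') (ξ : Fin b → Fin b → Ω' → ℝ) (α : Fin b)
    (c : Ω → Vertex b → Fin b) (ζ : Vertex b → Fin b → Ω → ℝ) : Prop where
  measurable_colour : Measurable c
  measurable_label : ∀ v i, Measurable (ζ v i)
  root_colour : ∀ᵐ ω ∂P, c ω [] = α
  uniform_colour : ∀ (n : ℕ) (κ : Vertex b → Fin b), IsProper κ →
    P (agreeUpTo c κ (n + 1)) = P (agreeUpTo c κ n) / ((b.factorial ^ b ^ n : ℕ) : ENNReal)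
  /- `s` is the set of parent endpoints; the edge chosen below `u ∈ s` leads to `f u :: u`. -/
  label_law : ∀ (s : Finset (Vertex b)) (f : Vertex b → Fin b) (A : Vertex b → Set ℝ),
    (∀ u ∈ s, MeasurableSet (A u)) →
    P[Set.indicator {ω | ∀ u ∈ s, ζ u (f u) ω ∈ A u} (fun _ => (1 : ℝ)) |
        MeasurableSpace.comap c inferInstance]
      =ᵐ[P] fun ω => ∏ u ∈ s, P'.real {ω' | ξ (c ω u) (c ω (f u :: u)) ω' ∈ A u}

/-- `ζ[v]`: the product of the labels along the path from the root to `v`. -/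
def pathProduct {b : ℕ} {Ω : Type*} (ζ : Vertex b → Fin b → Ω → ℝ) : Vertex b → Ω → ℝ
  | [], _ => 1
  | i :: v, ω => pathProduct ζ v ω * ζ v i ω

/-- `Z(x)`: the number of vertices `v` with `ζ[v] > x`. -/
def Z {b : ℕ} {Ω : Type*} (ζ : Vertex b → Fin b → Ω → ℝ) (x : ℝ) (ω : Ω) : ℕ∞ :=
  Set.encard {v : Vertex b | x < pathProduct ζ v ω}

section Moments

variable {b : ℕ} {Ω' : Type*} [MeasurableSpace Ω'] (P' : Measure Ω') (ξ : Fin b → Fin b → Ω' → ℝ)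

/-- The set `𝔻` of the real `s` for which all moments `𝔼 ξ_{ij}^s` are finite. -/
def momentDomain : Set ℝ :=
  {s | ∀ i j, Integrable (fun ω => ξ i j ω ^ s) P'}

/-- The matrix `m(s)` of the moments `𝔼 ξ_{ij}^s` (meaningful for `s ∈ 𝔻`). -/
def momentMatrix (s : ℝ) : Matrix (Fin b) (Fin b) ℝ :=
  Matrix.of fun i j => ∫ ω, ξ i j ω ^ s ∂P'

open Classical in
/-- `ρ(s)`: the largest eigenvalue of `m(s)`, and `+∞` if some entry of `m(s)` is infinite. -/
def rho (s : ℝ) : EReal :=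
  if s ∈ momentDomain P' ξ then
    ((sSup {r : ℝ | Module.End.HasEigenvalue (Matrix.toLin' (momentMatrix P' ξ s)) r} : ℝ) : EReal)
  else ⊤

/-- `λ = inf_{s ≥ 0} ρ(s)`. -/
def lam : EReal := ⨅ s ∈ Set.Ici (0 : ℝ), rho P' ξ s

/-- The regularity conditions. -/
structure Regular : Prop where
  unit_interval : Set.Icc 0 1 ⊆ momentDomain P' ξ
  zero_interior : (0 : ℝ) ∈ interior (momentDomain P' ξ)
  log_integrable : ∀ i j, Integrable (fun ω => Real.log (ξ i j ω)) P'
  mul_log_integrable : ∀ i j, Integrable (fun ω => ξ i j ω * Real.log (ξ i j ω)) P'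

end Moments

end ColouredTree

end

/-!
Taking logarithms turns `ζ[v]` into a sum along the path to `v`, so that the tree carries a
branching random walk whose steps depend on colours. Of the colouring only one property matters: it
is almost surely proper (`IsRandomEnvironment.ae_isProper`), so the children of any vertex carry
each colour exactly once. Hence, for a fixed proper colouring, first moments over the descendants of
a vertex do not depend on the colouring (`IsProper.sum_pathLaw`); they are given by `pathMeasure`,
whose Laplace transforms are the entries of the powers of the moment matrix. Bounds that are uniform
in the colouring carry over to the random one (`IsRandomEnvironment.lintegral_le`).

If `ρ(s) < 1` for some `s ≥ 0`, Perron's theorem shows that the row sums of the powers of the moment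
matrix are summable, so the sum of `ζ[v] ^ s` over all vertices has finite expectation, and only
finitely many `v` satisfy `ζ[v] > x` (`ae_Z_lt_top`).

If `ρ(s) > 1` for all `s ≥ 0` and the products are unbounded, compactness in `s` and a lower large
deviation bound (`exists_one_lt_convPow`) give a block length `n` and a `θ > 0` such that the
expected number `K` of descendants of colour `α`, `n` levels below a vertex of colour `α`, with
relative log-product `> θ` exceeds `1` (`exists_one_lt_pathMeasure`). Unboundedness enters by
making the Laplace transforms of the closed path measures tend to infinity with `s`. Then chains of
`k` such blocks are counted by the second moment method. Labels of sibling edges may be dependent,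
and even the families of labels below distinct vertices need not be jointly independent, so this is
no Galton-Watson process; but for a pair of chains it is enough to drop the constraint on one of
them in the block where they separate (`IsQuenched.exists_pairBound`), since then only one edge per
parent is involved. As `K > 1`, the second moment is comparable to the square of the first, and,
started from the `b ^ m` vertices of colour `α` at level `m + 1`, the count vanishes with probability
`O(b ^ (-m))`, uniformly in `k` (`IsQuenched.measureReal_compl_le`). Letting first `k` and then `m`
tend to infinity gives `Z(x) = ∞` almost surely (`ae_Z_eq_top`).
-/

noncomputable section

namespace ColouredTree

open Filter Topology
open scoped ENNReal

/-! ### Laplace transforms and convolution powers of measures on the line -/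

/-- The Laplace transform `∫ e^{sx} ν(dx)`, with values in `[0, ∞]`. -/
def laplace (s : ℝ) (ν : Measure ℝ) : ℝ≥0∞ := ∫⁻ x, ENNReal.ofReal (Real.exp (s * x)) ∂ν

/-- The `k`-th convolution power of a measure on the line. -/
def convPow (ν : Measure ℝ) : ℕ → Measure ℝ
  | 0 => Measure.dirac 0
  | k + 1 => (convPow ν k).conv ν

lemma measurable_exp_mul (s : ℝ) : Measurable fun x : ℝ => ENNReal.ofReal (Real.exp (s * x)) := by
  fun_prop

lemma laplace_dirac_zero (s : ℝ) : laplace s (Measure.dirac 0) = 1 := by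
  simp [laplace]

lemma laplace_mono (s : ℝ) {ν ν' : Measure ℝ} (h : ν ≤ ν') : laplace s ν ≤ laplace s ν' :=
  lintegral_mono' h le_rfl

lemma laplace_conv (s : ℝ) (ν ν' : Measure ℝ) [SFinite ν'] :
    laplace s (ν.conv ν') = laplace s ν * laplace s ν' := by
  unfold laplace
  rw [Measure.lintegral_conv (measurable_exp_mul s)]
  simp_rw [mul_add, Real.exp_add, ENNReal.ofReal_mul (Real.exp_pos _).le]
  simp_rw [lintegral_const_mul _ (measurable_exp_mul s)]
  rw [lintegral_mul_const _ (measurable_exp_mul s)]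

lemma laplace_finset_sum {ι : Type*} (s : ℝ) (t : Finset ι) (ν : ι → Measure ℝ) :
    laplace s (∑ i ∈ t, ν i) = ∑ i ∈ t, laplace s (ν i) := by
  unfold laplace
  rw [lintegral_finsetSum_measure]

lemma laplace_map {Ω : Type*} [MeasurableSpace Ω] (s : ℝ) (P : Measure Ω) {f : Ω → ℝ}
    (hf : Measurable f) :
    laplace s (P.map f) = ∫⁻ ω, ENNReal.ofReal (Real.exp (s * f ω)) ∂P := by
  unfold laplace
  rw [lintegral_map (measurable_exp_mul s) hf]

lemma laplace_ne_zero (s : ℝ) {ν : Measure ℝ} (hν : ν ≠ 0) : laplace s ν ≠ 0 := by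
  unfold laplace
  rw [Ne, lintegral_eq_zero_iff (measurable_exp_mul s)]
  intro h
  apply hν
  rw [← Measure.measure_univ_eq_zero]
  rw [Filter.EventuallyEq, ae_iff] at h
  simpa [Real.exp_pos] using h

/-- By Fatou's lemma the Laplace transform is lower semicontinuous. -/
lemma isOpen_one_lt_laplace (ν : Measure ℝ) : IsOpen {s : ℝ | 1 < laplace s ν} := by
  rw [← isClosed_compl_iff]
  apply IsSeqClosed.isClosed
  intro u s hu hus
  simp only [Set.mem_compl_iff, Set.mem_ofPred_eq, not_lt] at hu ⊢
  have h1 : laplace s ν ≤ liminf (fun k => laplace (u k) ν) atTop := by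
    unfold laplace
    refine le_trans (le_of_eq ?_) (lintegral_liminf_le fun k => measurable_exp_mul (u k))
    refine lintegral_congr fun x => ?_
    refine (Tendsto.liminf_eq ?_).symm
    exact (ENNReal.continuous_ofReal.tendsto _).comp
      ((Real.continuous_exp.tendsto _).comp (hus.mul_const x))
  refine h1.trans ?_
  refine (liminf_le_liminf (Eventually.of_forall hu)).trans ?_
  simp

lemma laplace_ge_of_Ioi {s δ : ℝ} (hs : 0 ≤ s) (ν : Measure ℝ) :
    ν (Set.Ioi δ) * ENNReal.ofReal (Real.exp (s * δ)) ≤ laplace s ν := by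
  have h : ∫⁻ x in Set.Ioi δ, ENNReal.ofReal (Real.exp (s * δ)) ∂ν ≤ laplace s ν := by
    refine (setLIntegral_mono (measurable_exp_mul s) fun x hx => ?_).trans
      (setLIntegral_le_lintegral _ _)
    apply ENNReal.ofReal_le_ofReal
    exact Real.exp_le_exp.2 (mul_le_mul_of_nonneg_left (Set.mem_Ioi.1 hx).le hs)
  rwa [setLIntegral_const, mul_comm] at h

lemma exists_pos_Ioi_of_pos {ν : Measure ℝ} (h : 0 < ν (Set.Ioi 0)) :
    ∃ δ : ℝ, 0 < δ ∧ 0 < ν (Set.Ioi δ) := by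
  by_contra! hcon
  have h1 : Set.Ioi (0 : ℝ) = ⋃ n : ℕ, Set.Ioi (1 / ((n : ℝ) + 1)) := by
    ext x
    simp only [Set.mem_Ioi, Set.mem_iUnion]
    exact ⟨fun hx => exists_nat_one_div_lt hx, fun ⟨n, hn⟩ => lt_trans (by positivity) hn⟩
  rw [h1] at h
  refine h.ne' (measure_iUnion_null fun n => ?_)
  exact le_antisymm (hcon _ (by positivity)) (zero_le)

/-- A measure charging `(0, ∞)` has large Laplace transform at large parameters. -/
lemma exists_le_laplace {ν : Measure ℝ} (h : 0 < ν (Set.Ioi 0)) (B : ℝ) :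
    ∃ S : ℝ, 0 < S ∧ ∀ s, S ≤ s → ENNReal.ofReal B < laplace s ν := by
  obtain ⟨δ, hδ, hp⟩ := exists_pos_Ioi_of_pos h
  have h1 : Tendsto (fun s : ℝ => ν (Set.Ioi δ) * ENNReal.ofReal (Real.exp (s * δ))) atTop
      (𝓝 (ν (Set.Ioi δ) * ∞)) := by
    apply ENNReal.Tendsto.const_mul _ (Or.inl (by simp))
    exact ENNReal.tendsto_ofReal_atTop.comp
      (Real.tendsto_exp_atTop.comp (tendsto_id.atTop_mul_const hδ))
  rw [ENNReal.mul_top hp.ne'] at h1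
  obtain ⟨S, hS⟩ := eventually_atTop.1
    (h1.eventually (lt_mem_nhds (ENNReal.ofReal_lt_top : ENNReal.ofReal B < ∞)))
  refine ⟨max S 1, by positivity, fun s hs => ?_⟩
  exact (hS s ((le_max_left _ _).trans hs)).trans_le
    (laplace_ge_of_Ioi (le_trans (by positivity) hs) ν)

lemma conv_mono {ν₁ ν₂ ν₃ ν₄ : Measure ℝ} [SFinite ν₁] [SFinite ν₂] [SFinite ν₃] [SFinite ν₄]
    (h : ν₁ ≤ ν₂) (h' : ν₃ ≤ ν₄) : ν₁.conv ν₃ ≤ ν₂.conv ν₄ := by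
  unfold Measure.conv
  exact Measure.map_mono (Measure.prod_mono h h') (by fun_prop)

lemma mul_Ioi_le_conv_Ioi (ν ν' : Measure ℝ) [SFinite ν] [SFinite ν'] (x y : ℝ) :
    ν (Set.Ioi x) * ν' (Set.Ioi y) ≤ (ν.conv ν') (Set.Ioi (x + y)) := by
  unfold Measure.conv
  rw [Measure.map_apply (by fun_prop) measurableSet_Ioi, ← Measure.prod_prod]
  refine measure_mono ?_
  rintro ⟨u, v⟩ ⟨hu, hv⟩
  exact add_lt_add (Set.mem_Ioi.1 hu) (Set.mem_Ioi.1 hv)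

instance isFiniteMeasure_convPow (ν : Measure ℝ) [IsFiniteMeasure ν] (k : ℕ) :
    IsFiniteMeasure (convPow ν k) := by
  induction k with
  | zero => unfold convPow; infer_instance
  | succ k ih => unfold convPow; infer_instance

lemma laplace_convPow (s : ℝ) (ν : Measure ℝ) [IsFiniteMeasure ν] (k : ℕ) :
    laplace s (convPow ν k) = laplace s ν ^ k := by
  induction k with
  | zero => simp [convPow, laplace_dirac_zero]
  | succ k ih => rw [convPow, laplace_conv, ih, pow_succ]

/-! ### A lower large deviation bound -/

/-- Chernoff's bound from below: the mass which the `k`-th convolution power, tilted by `e^{sx}`,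
gives to `x ≤ μ₁ k` and to `x ≥ μ₂ k` is controlled by the Laplace transform at `s - h` and at
`s + h`. If the transform at `s` dominates both, most of the tilted mass sits in `(μ₁ k, μ₂ k)`,
where the tilt is at most `e^{s μ₂ k}`. -/
lemma laplace_pow_le {ν : Measure ℝ} [IsFiniteMeasure ν] {s h μ₁ μ₂ : ℝ} (hs : 0 ≤ s) (hh : 0 ≤ h)
    (k : ℕ) :
    laplace s ν ^ k ≤ (ENNReal.ofReal (Real.exp (h * μ₁)) * laplace (s - h) ν) ^ k
      + (ENNReal.ofReal (Real.exp (-(h * μ₂))) * laplace (s + h) ν) ^ k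
      + ENNReal.ofReal (Real.exp (s * μ₂)) ^ k * convPow ν k (Set.Ioi (μ₁ * k)) := by
  have hexp : ∀ y : ℝ, ENNReal.ofReal (Real.exp y) ^ k = ENNReal.ofReal (Real.exp (k * y)) := by
    intro y
    rw [← ENNReal.ofReal_pow (Real.exp_pos _).le, ← Real.exp_nat_mul]
  have key : ∀ x : ℝ, ENNReal.ofReal (Real.exp (s * x)) ≤
      ENNReal.ofReal (Real.exp (h * μ₁)) ^ k * ENNReal.ofReal (Real.exp ((s - h) * x))
      + ENNReal.ofReal (Real.exp (-(h * μ₂))) ^ k * ENNReal.ofReal (Real.exp ((s + h) * x))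
      + (Set.Ioi (μ₁ * k)).indicator (fun _ => ENNReal.ofReal (Real.exp (s * μ₂)) ^ k) x := by
    intro x
    rw [hexp, hexp, hexp, ← ENNReal.ofReal_mul (Real.exp_pos _).le, ← Real.exp_add,
      ← ENNReal.ofReal_mul (Real.exp_pos _).le, ← Real.exp_add]
    rcases le_or_gt x (μ₁ * k) with h1 | h1
    · refine le_trans ?_ (le_self_add.trans le_self_add)
      refine ENNReal.ofReal_le_ofReal (Real.exp_le_exp.2 ?_)
      nlinarith [mul_le_mul_of_nonneg_left h1 hh]
    rcases le_or_gt (μ₂ * k) x with h2 | h2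
    · refine le_trans ?_ (le_add_self.trans le_self_add)
      refine ENNReal.ofReal_le_ofReal (Real.exp_le_exp.2 ?_)
      nlinarith [mul_le_mul_of_nonneg_left h2 hh]
    · refine le_trans ?_ le_add_self
      rw [Set.indicator_of_mem (Set.mem_Ioi.2 h1)]
      refine ENNReal.ofReal_le_ofReal (Real.exp_le_exp.2 ?_)
      nlinarith [mul_le_mul_of_nonneg_left h2.le hs]
  rw [← laplace_convPow s ν k, mul_pow, mul_pow, ← laplace_convPow (s - h) ν k,
    ← laplace_convPow (s + h) ν k]
  refine (lintegral_mono key).trans (le_of_eq ?_)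
  rw [lintegral_add_right _ (measurable_const.indicator measurableSet_Ioi),
    lintegral_add_right _ ((measurable_exp_mul _).const_mul _),
    lintegral_const_mul _ (measurable_exp_mul _), lintegral_const_mul _ (measurable_exp_mul _),
    lintegral_indicator_const measurableSet_Ioi]
  rfl

lemma exists_one_lt_convPow_of_lt {ν : Measure ℝ} [IsFiniteMeasure ν] {s h μ₁ μ₂ : ℝ}
    (hs : 0 ≤ s) (hh : 0 ≤ h) (hμ : 0 < μ₁) {g g₁ g₂ : ℝ} (hg : 0 < g) (hg1 : 0 ≤ g₁)
    (hg2 : 0 ≤ g₂)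
    (hG : laplace s ν = ENNReal.ofReal g) (hG1 : laplace (s - h) ν = ENNReal.ofReal g₁)
    (hG2 : laplace (s + h) ν = ENNReal.ofReal g₂)
    (h1 : Real.exp (h * μ₁) * g₁ < g) (h2 : Real.exp (-(h * μ₂)) * g₂ < g)
    (h3 : Real.exp (s * μ₂) < g) :
    ∃ k : ℕ, 1 ≤ k ∧ ∃ θ : ℝ, 0 < θ ∧ 1 < convPow ν k (Set.Ioi θ) := by
  have ht : ∀ x : ℝ, 0 ≤ x → x < g → Tendsto (fun k : ℕ => (x / g) ^ k) atTop (𝓝 0) :=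
    fun x hx hxg =>
    tendsto_pow_atTop_nhds_zero_of_lt_one (by positivity) ((div_lt_one hg).2 hxg)
  have hsum := ((ht _ (by positivity) h1).add (ht _ (by positivity) h2)).add
    (ht _ (by positivity) h3)
  simp only [add_zero] at hsum
  obtain ⟨k, hk, hk1⟩ := ((hsum.eventually (gt_mem_nhds zero_lt_one)).and
    (eventually_ge_atTop 1)).exists
  refine ⟨k, hk1, μ₁ * k, by positivity, ?_⟩
  by_contra! hle
  have hb := laplace_pow_le (ν := ν) (μ₁ := μ₁) (μ₂ := μ₂) hs hh k
  have hb' := hb.trans (add_le_add_right (mul_le_mul_right hle _) _)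
  rw [hG, hG1, hG2, mul_one, ← ENNReal.ofReal_mul (by positivity),
    ← ENNReal.ofReal_mul (by positivity), ← ENNReal.ofReal_pow (by positivity),
    ← ENNReal.ofReal_pow (by positivity), ← ENNReal.ofReal_pow (by positivity),
    ← ENNReal.ofReal_pow (by positivity), ← ENNReal.ofReal_add (by positivity) (by positivity),
    ← ENNReal.ofReal_add (by positivity) (by positivity),
    ENNReal.ofReal_le_ofReal_iff (by positivity)] at hb'
  simp only [div_pow] at hk
  rw [← add_div, ← add_div, div_lt_one (by positivity)] at hk
  linarith

/-- Choice of the parameters of the tilting argument: a differentiable function that is positive on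
`[0, S]` and larger at `S` than at `0` has a point `s`, just to the right of a minimizer of
`φ s - a s` with `a` small, at which it increases, but with a slope `< φ s / s`. -/
lemma exists_tilt {φ : ℝ → ℝ} (hφ : Differentiable ℝ φ) {S : ℝ} (hS : 0 < S)
    (hpos : ∀ s ∈ Set.Icc 0 S, 0 < φ s) (hlt : φ 0 < φ S) :
    ∃ s h μ₁ μ₂ : ℝ, 0 ≤ s ∧ 0 < h ∧ 0 < μ₁ ∧ h * μ₁ + φ (s - h) < φ s ∧
      -(h * μ₂) + φ (s + h) < φ s ∧ s * μ₂ < φ s := by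
  obtain ⟨t, ht, hmin⟩ := (isCompact_Icc (a := (0 : ℝ)) (b := S)).exists_isMinOn
    (Set.nonempty_Icc.2 hS.le) hφ.continuous.continuousOn
  have hm : 0 < φ t := hpos t ht
  set a : ℝ := min ((φ S - φ 0) / (2 * S)) (φ t / (4 * S)) with ha
  have ha0 : 0 < a := lt_min (div_pos (by linarith) (by positivity)) (by positivity)
  have ha1 : a * S < φ S - φ 0 := by
    have := min_le_left ((φ S - φ 0) / (2 * S)) (φ t / (4 * S))
    rw [← ha, le_div_iff₀ (by positivity)] at this
    nlinarith
  have ha2 : 4 * (a * S) ≤ φ t := by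
    have := min_le_right ((φ S - φ 0) / (2 * S)) (φ t / (4 * S))
    rw [← ha, le_div_iff₀ (by positivity)] at this
    linarith
  have hψ : Differentiable ℝ fun s => φ s - a * s := by fun_prop
  obtain ⟨m, hm', hmmin⟩ := (isCompact_Icc (a := (0 : ℝ)) (b := S)).exists_isMinOn
    (Set.nonempty_Icc.2 hS.le) hψ.continuous.continuousOn
  have hmS : m < S := by
    refine lt_of_le_of_ne hm'.2 fun h => ?_
    have := hmmin (Set.left_mem_Icc.2 hS.le)
    simp only [Set.mem_ofPred_eq, h] at this
    linarith
  have hφm : φ t ≤ φ m := hmin hm'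
  set d := deriv φ m with hd
  have hderiv : HasDerivAt φ d m := (hφ m).hasDerivAt
  have hd2 : m * (2 * d) < φ m := by
    rcases hm'.1.eq_or_lt with h0 | h0
    · rw [← h0, zero_mul, h0]; linarith
    · have hloc : IsLocalMin (fun s => φ s - a * s) m :=
        hmmin.isLocalMin (Icc_mem_nhds h0 hmS)
      have h1 : HasDerivAt (fun s => φ s - a * s) (d - a * 1) m :=
        hderiv.sub ((hasDerivAt_id m).const_mul a)
      have h2 := hloc.hasDerivAt_eq_zero h1
      have h3 : d = a := by linarith
      rw [h3]
      nlinarith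
  obtain ⟨μ₂, hμ1, hμ2⟩ : ∃ μ₂, 2 * d < μ₂ ∧ m * μ₂ < φ m := by
    have hc : ContinuousAt (fun y : ℝ => m * y) (2 * d) := by fun_prop
    have he := (hc.eventually (gt_mem_nhds hd2)).filter_mono
      (nhdsWithin_le_nhds (s := Set.Ioi (2 * d)))
    obtain ⟨y, hy1, hy2⟩ := (he.and self_mem_nhdsWithin).exists
    exact ⟨y, hy2, hy1⟩
  have e1 : ∀ᶠ h : ℝ in 𝓝[>] 0, h + m < S := by
    have hc : ContinuousAt (fun h : ℝ => h + m) 0 := by fun_prop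
    exact (hc.eventually (gt_mem_nhds (by simpa using hmS))).filter_mono nhdsWithin_le_nhds
  have e2 : ∀ᶠ h : ℝ in 𝓝[>] 0, (m + h) * μ₂ - φ (m + h) < 0 := by
    have hc : ContinuousAt (fun h : ℝ => (m + h) * μ₂ - φ (m + h)) 0 := by
      have := hφ.continuous
      fun_prop
    exact (hc.eventually (gt_mem_nhds (by simpa using hμ2))).filter_mono nhdsWithin_le_nhds
  have e3 : ∀ᶠ h : ℝ in 𝓝[>] 0, φ (m + 2 * h) - φ m < h * μ₂ := by
    have hf : HasDerivAt (fun h : ℝ => φ (m + 2 * h)) (d * (2 * 1)) 0 := by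
      have h1 : HasDerivAt (fun h : ℝ => m + 2 * h) (2 * 1) 0 :=
        ((hasDerivAt_id (0 : ℝ)).const_mul 2).const_add m
      have h2 : HasDerivAt φ d (m + 2 * 0) := by simpa using hderiv
      exact h2.comp 0 h1
    have hs := (hasDerivAt_iff_tendsto_slope_zero.1 hf).eventually
      (gt_mem_nhds (show d * (2 * 1) < μ₂ by linarith))
    filter_upwards [nhdsWithin_mono 0 (fun x hx => ne_of_gt (Set.mem_Ioi.1 hx)) hs,
      self_mem_nhdsWithin] with h hh hpos
    have hpos' : 0 < h := hpos
    simp only [zero_add, mul_zero, add_zero, smul_eq_mul] at hh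
    rw [inv_mul_lt_iff₀ hpos'] at hh
    exact hh
  obtain ⟨h, ⟨⟨h1, h2⟩, h3⟩, h4⟩ := (((e1.and e2).and e3).and self_mem_nhdsWithin).exists
  have hh : 0 < h := h4
  have hinc : φ m + a * h ≤ φ (m + h) := by
    have := hmmin (show m + h ∈ Set.Icc 0 S from ⟨by linarith [hm'.1], by linarith⟩)
    simp only [Set.mem_ofPred_eq] at this
    linarith
  refine ⟨m + h, h, a / 2, μ₂, by linarith [hm'.1], hh, by positivity, ?_, ?_, by linarith⟩
  · rw [add_sub_cancel_right]
    nlinarith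
  · rw [add_assoc, ← two_mul]
    nlinarith [mul_pos ha0 hh]

/-- The easy half of Cramér's theorem for finite measures: if `∫ e^{sx} ν(dx) > 1` for all `s ≥ 0`
and `ν` charges `(0, ∞)`, then some convolution power of `ν` gives mass `> 1` to a half-line
`(θ, ∞)` with `θ > 0`. -/
theorem exists_one_lt_convPow {ν : Measure ℝ} [IsFiniteMeasure ν]
    (h1 : ∀ s, 0 ≤ s → 1 < laplace s ν) (h2 : 0 < ν (Set.Ioi 0)) :
    ∃ k : ℕ, 1 ≤ k ∧ ∃ θ : ℝ, 0 < θ ∧ 1 < convPow ν k (Set.Ioi θ) := by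
  -- Truncation to `[-R, R]` makes the Laplace transform entire.
  let T : ℕ → Measure ℝ := fun R => ν.restrict (Set.Icc (-(R : ℝ)) R)
  have hTle : ∀ R, T R ≤ ν := fun R => Measure.restrict_le_self
  have hTmono : Monotone T := fun R R' h => Measure.restrict_mono
    (Set.Icc_subset_Icc (neg_le_neg (Nat.cast_le.2 h)) (Nat.cast_le.2 h)) le_rfl
  have hlim : ∀ s, ⨆ R, laplace s (T R) = laplace s ν := by
    intro s
    unfold laplace
    have hU : (⋃ R : ℕ, Set.Icc (-(R : ℝ)) R) = Set.univ := by
      refine Set.eq_univ_of_forall fun x => Set.mem_iUnion.2 ?_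
      obtain ⟨R, hR⟩ := exists_nat_ge |x|
      exact ⟨R, abs_le.1 hR⟩
    have hm : Monotone fun R : ℕ => Set.Icc (-(R : ℝ)) R := fun R R' h =>
      Set.Icc_subset_Icc (neg_le_neg (Nat.cast_le.2 h)) (Nat.cast_le.2 h)
    rw [← setLIntegral_iUnion_of_directed _ hm.directed_le, hU, Measure.restrict_univ]
  obtain ⟨S, hS, hSlt⟩ := exists_le_laplace h2 (2 * ν.real Set.univ)
  have hS' : 2 * ν Set.univ < laplace S ν := by
    have := hSlt S le_rfl
    rwa [ENNReal.ofReal_mul (by norm_num), Measure.real, ENNReal.ofReal_toReal (by simp),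
      ENNReal.ofReal_ofNat] at this
  obtain ⟨R₁, hR₁⟩ := lt_iSup_iff.1 ((hlim S).symm ▸ hS')
  obtain ⟨R₂, hR₂⟩ := (isCompact_Icc (a := (0 : ℝ)) (b := S)).elim_directed_cover
    (fun R : ℕ => {s : ℝ | 1 < laplace s (T R)}) (fun R => isOpen_one_lt_laplace _)
    (fun s hs => by
      obtain ⟨R, hR⟩ := lt_iSup_iff.1 ((hlim s).symm ▸ h1 s hs.1)
      exact Set.mem_iUnion.2 ⟨R, hR⟩)
    (Monotone.directed_le fun R R' h s hs =>
      (show 1 < laplace s (T R) from hs).trans_le (laplace_mono s (hTmono h)))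
  set R := max R₁ R₂
  have hR1 : 2 * ν Set.univ < laplace S (T R) :=
    hR₁.trans_le (laplace_mono S (hTmono (le_max_left _ _)))
  have hR2 : ∀ s ∈ Set.Icc 0 S, 1 < laplace s (T R) := fun s hs =>
    (hR₂ hs : 1 < laplace s (T R₂)).trans_le (laplace_mono s (hTmono (le_max_right _ _)))
  have hint : ∀ s : ℝ, Integrable (fun x : ℝ => Real.exp (s * id x)) (T R) := by
    intro s
    have : IntegrableOn (fun x : ℝ => Real.exp (s * id x)) (Set.Icc (-(R : ℝ)) R) ν :=
      ContinuousOn.integrableOn_compact isCompact_Icc (by fun_prop)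
    exact this
  set G : ℝ → ℝ := ProbabilityTheory.mgf id (T R) with hGdef
  have hG : ∀ s, laplace s (T R) = ENNReal.ofReal (G s) := fun s =>
    (ofReal_integral_eq_lintegral_ofReal (hint s)
      (Eventually.of_forall fun x => (Real.exp_pos _).le)).symm
  have hTne : T R ≠ 0 := by
    intro h
    have := hR2 0 ⟨le_rfl, hS.le⟩
    simp [h, laplace] at this
  have hGpos : ∀ s, 0 < G s := by
    intro s
    have := (laplace_ne_zero s hTne)
    rw [hG] at this
    exact ENNReal.ofReal_pos.1 (pos_iff_ne_zero.2 this)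
  have hGd : Differentiable ℝ G := fun s => ProbabilityTheory.differentiableAt_mgf (by
    have : ProbabilityTheory.integrableExpSet id (T R) = Set.univ :=
      Set.eq_univ_of_forall hint
    simp [this])
  have hφd : Differentiable ℝ fun s => Real.log (G s) := hGd.log fun s => (hGpos s).ne'
  obtain ⟨s, h, μ₁, μ₂, hs, hh, hμ, c1, c2, c3⟩ := exists_tilt hφd hS
    (fun s hs => Real.log_pos (by
      have := hR2 s hs
      rw [hG, ← ENNReal.ofReal_one] at this
      exact (ENNReal.ofReal_lt_ofReal_iff (hGpos s)).1 this))
    (by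
      refine Real.log_lt_log (hGpos 0) ?_
      have h0 : laplace 0 (T R) ≤ 2 * ν Set.univ := by
        refine (laplace_mono 0 (hTle R)).trans ?_
        simp only [laplace, zero_mul, Real.exp_zero, ENNReal.ofReal_one, lintegral_const, one_mul]
        exact le_mul_of_one_le_left' one_le_two
      have := h0.trans_lt hR1
      rw [hG, hG] at this
      exact (ENNReal.ofReal_lt_ofReal_iff (hGpos S)).1 this)
  have hexp : ∀ x u v : ℝ, x + Real.log (G u) < Real.log (G v) → Real.exp x * G u < G v := by
    intro x u v hx
    have := Real.exp_lt_exp.2 hx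
    rwa [Real.exp_add, Real.exp_log (hGpos u), Real.exp_log (hGpos v)] at this
  obtain ⟨k, hk, θ, hθ, hlt⟩ := exists_one_lt_convPow_of_lt (ν := T R) hs hh.le hμ (hGpos s)
    (hGpos _).le (hGpos _).le (hG s) (hG _) (hG _) (hexp _ _ _ c1) (hexp _ _ _ c2)
    (by rw [← Real.exp_log (hGpos s)]; exact Real.exp_lt_exp.2 c3)
  refine ⟨k, hk, θ, hθ, hlt.trans_le ?_⟩
  have hle : ∀ k, convPow (T R) k ≤ convPow ν k := by
    intro k
    induction k with
    | zero => exact le_rfl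
    | succ k ih => exact conv_mono ih (hTle R)
  exact hle k _

/-! ### Positive matrices -/

section PositiveMatrix

variable {ι : Type*} [Fintype ι] {M : Matrix ι ι ℝ}

lemma mulVec_pos (hM : ∀ i j, 0 < M i j) {x : ι → ℝ} (hx : ∀ i, 0 ≤ x i) (hx0 : x ≠ 0) (i : ι) :
    0 < M.mulVec x i := by
  obtain ⟨j, hj⟩ := Function.ne_iff.1 hx0
  refine Finset.sum_pos' (fun k _ => mul_nonneg (hM i k).le (hx k)) ⟨j, Finset.mem_univ j, ?_⟩
  exact mul_pos (hM i j) (lt_of_le_of_ne (hx j) (Ne.symm hj))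

/-- Perron's theorem (existence): the pair `(r, x)` maximizes `r` subject to `r x ≤ M x`, `x` in
the simplex. If `M x ≠ r x`, then `M x` in place of `x` allows a larger `r`. -/
theorem exists_perron_eigenvector [Nonempty ι] (hM : ∀ i j, 0 < M i j) :
    ∃ (r : ℝ) (x : ι → ℝ), (∀ i, 0 < x i) ∧ M.mulVec x = r • x ∧ 0 < r := by
  classical
  let C : Set (ℝ × (ι → ℝ)) :=
    {p | 0 ≤ p.1 ∧ p.2 ∈ stdSimplex ℝ ι ∧ ∀ i, p.1 * p.2 i ≤ M.mulVec p.2 i}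
  have hcont : ∀ i, Continuous fun x : ι → ℝ => M.mulVec x i := fun i =>
    (continuous_apply i).comp (Continuous.matrix_mulVec continuous_const continuous_id)
  have hclosed : IsClosed C := by
    have h1 : IsClosed {p : ℝ × (ι → ℝ) | 0 ≤ p.1} := isClosed_le continuous_const continuous_fst
    have h2 : IsClosed {p : ℝ × (ι → ℝ) | p.2 ∈ stdSimplex ℝ ι} :=
      (isClosed_stdSimplex ℝ ι).preimage continuous_snd
    have h3 : IsClosed {p : ℝ × (ι → ℝ) | ∀ i, p.1 * p.2 i ≤ M.mulVec p.2 i} := by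
      simp only [Set.ofPred_forall]
      exact isClosed_iInter fun i => isClosed_le
        (continuous_fst.mul ((continuous_apply i).comp continuous_snd))
        ((hcont i).comp continuous_snd)
    exact h1.inter (h2.inter h3)
  have hsub : C ⊆ Set.Icc 0 (∑ i, ∑ j, M i j) ×ˢ stdSimplex ℝ ι := by
    rintro ⟨r, x⟩ ⟨hr, hx, hrx⟩
    refine ⟨⟨hr, ?_⟩, hx⟩
    calc r = ∑ i, r * x i := by rw [← Finset.mul_sum, hx.2, mul_one]
      _ ≤ ∑ i, M.mulVec x i := Finset.sum_le_sum fun i _ => hrx i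
      _ ≤ ∑ i, ∑ j, M i j := by
        refine Finset.sum_le_sum fun i _ => Finset.sum_le_sum fun j _ => ?_
        have hxj : x j ≤ 1 := by
          rw [← hx.2]
          exact Finset.single_le_sum (fun k _ => hx.1 k) (Finset.mem_univ j)
        exact mul_le_of_le_one_right (hM i j).le hxj
  have hcomp : IsCompact C := (isCompact_Icc.prod (isCompact_stdSimplex ℝ ι)).of_isClosed_subset
    hclosed hsub
  have hne : C.Nonempty := by
    obtain ⟨i⟩ := ‹Nonempty ι›
    refine ⟨(0, Pi.single i 1), le_rfl, single_mem_stdSimplex ℝ i, fun j => ?_⟩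
    rw [zero_mul]
    exact Finset.sum_nonneg fun k _ =>
      mul_nonneg (hM j k).le ((single_mem_stdSimplex ℝ i).1 k)
  obtain ⟨⟨r, x⟩, ⟨hr, hx, hrx⟩, hmax⟩ := hcomp.exists_isMaxOn hne continuous_fst.continuousOn
  have hx0 : x ≠ 0 := by
    rintro rfl
    simpa using hx.2
  have hy : ∀ i, 0 < M.mulVec x i := mulVec_pos hM hx.1 hx0
  have heq : M.mulVec x = r • x := by
    by_contra hcon
    set y := M.mulVec x with hydef
    have hz : ∀ i, 0 < M.mulVec (y - r • x) i := mulVec_pos hM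
      (fun i => by simpa using hrx i) (sub_ne_zero.2 hcon)
    obtain ⟨i₀, hi₀⟩ := Finite.exists_min fun i => M.mulVec (y - r • x) i / y i
    set ε := M.mulVec (y - r • x) i₀ / y i₀
    have hε : 0 < ε := div_pos (hz _) (hy _)
    have hgain : ∀ i, (r + ε) * y i ≤ M.mulVec y i := by
      intro i
      have h1 : ε * y i ≤ M.mulVec (y - r • x) i := (le_div_iff₀ (hy i)).1 (hi₀ i)
      rw [Matrix.mulVec_sub, Matrix.mulVec_smul, ← hydef] at h1
      simp only [Pi.sub_apply, Pi.smul_apply, smul_eq_mul] at h1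
      linarith
    have hsum : 0 < ∑ i, y i := Finset.sum_pos (fun i _ => hy i) Finset.univ_nonempty
    have hmem : (r + ε, (∑ i, y i)⁻¹ • y) ∈ C := by
      refine ⟨by positivity, ⟨fun i => ?_, ?_⟩, fun i => ?_⟩
      · exact mul_nonneg (by positivity) (hy i).le
      · simp only [Pi.smul_apply, smul_eq_mul]
        rw [← Finset.mul_sum, inv_mul_cancel₀ hsum.ne']
      · rw [Matrix.mulVec_smul]
        simp only [Pi.smul_apply, smul_eq_mul]
        rw [mul_left_comm]
        exact mul_le_mul_of_nonneg_left (hgain i) (by positivity)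
    have := hmax hmem
    simp only [Set.mem_ofPred_eq] at this
    linarith
  have hrx' : ∀ i, 0 < r * x i := fun i => by
    have := hy i
    rwa [heq] at this
  have hr0 : 0 < r := by
    obtain ⟨i⟩ := ‹Nonempty ι›
    exact lt_of_le_of_ne hr fun h => by simpa [← h] using hrx' i
  exact ⟨r, x, fun i => pos_of_mul_pos_right (hrx' i) hr, heq, hr0⟩

variable [DecidableEq ι]

lemma pow_nonneg_apply (hM : ∀ i j, 0 ≤ M i j) (n : ℕ) (i j : ι) : 0 ≤ (M ^ n) i j := by
  induction n generalizing j with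
  | zero => rw [pow_zero, Matrix.one_apply]; split_ifs <;> norm_num
  | succ n ih =>
    rw [pow_succ, Matrix.mul_apply]
    exact Finset.sum_nonneg fun k _ => mul_nonneg (ih k) (hM k j)

/-- If all real eigenvalues of a positive matrix are at most `a < 1`, its powers are summable:
by Perron's theorem the row sums of `M ^ n` are dominated by a multiple of `r ^ n`, `r` being an
eigenvalue. -/
lemma summable_pow_row [Nonempty ι] (hM : ∀ i j, 0 < M i j) {a : ℝ} (ha : a < 1)
    (hle : ∀ r, Module.End.HasEigenvalue (Matrix.toLin' M) r → r ≤ a) (i : ι) :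
    Summable fun n => ∑ j, (M ^ n) i j := by
  obtain ⟨r, x, hx, hMx, hr⟩ := exists_perron_eigenvector hM
  have hr1 : r < 1 := by
    refine (hle r ?_).trans_lt ha
    refine Module.End.hasEigenvalue_of_hasEigenvector (x := x) ⟨?_, ?_⟩
    · rw [Module.End.mem_eigenspace_iff, Matrix.toLin'_apply, hMx]
    · rintro rfl
      exact lt_irrefl _ (hx i)
  obtain ⟨i₀, hi₀⟩ := Finite.exists_min x
  have hpow : ∀ n, (M ^ n).mulVec x = r ^ n • x := by
    intro n
    induction n with
    | zero => simp
    | succ n ih =>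
      rw [pow_succ, ← Matrix.mulVec_mulVec, hMx, Matrix.mulVec_smul, ih, smul_smul, pow_succ,
        mul_comm]
  refine Summable.of_nonneg_of_le (f := fun n => (x i₀)⁻¹ * x i * r ^ n)
    (fun n => Finset.sum_nonneg fun j _ => pow_nonneg_apply (fun i j => (hM i j).le) n i j)
    (fun n => ?_) ((summable_geometric_of_lt_one hr.le hr1).mul_left _)
  have h1 : (∑ j, (M ^ n) i j) * x i₀ ≤ r ^ n * x i := by
    have := congrFun (hpow n) i
    simp only [Pi.smul_apply, smul_eq_mul] at this
    rw [← this, Finset.sum_mul]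
    exact Finset.sum_le_sum fun j _ => mul_le_mul_of_nonneg_left (hi₀ j)
      (pow_nonneg_apply (fun i j => (hM i j).le) n i j)
  rw [mul_assoc, inv_mul_eq_div, le_div_iff₀ (hx i₀)]
  linarith

/-- If a positive matrix has a real eigenvalue `r > 1`, with eigenvector `x`, then
`r ^ n |x| ≤ M ^ n |x|`, so the diagonal entries of `M ^ n` are unbounded. -/
lemma exists_one_lt_pow_diag (hM : ∀ i j, 0 < M i j) {r : ℝ} (hr : 1 < r)
    (h : Module.End.HasEigenvalue (Matrix.toLin' M) r) (i : ι) : ∃ n, 1 < (M ^ n) i i := by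
  obtain ⟨x, hx⟩ := h.exists_hasEigenvector
  have hMx : M.mulVec x = r • x := by
    rw [← Matrix.toLin'_apply]
    exact hx.apply_eq_smul
  set y : ι → ℝ := fun j => |x j| with hy
  have hy0 : y ≠ 0 := fun h0 => hx.2 (funext fun j => abs_eq_zero.1 (congrFun h0 j))
  have hy1 : ∀ j, r * y j ≤ M.mulVec y j := by
    intro j
    have h1 : r * y j = |M.mulVec x j| := by
      rw [hMx]
      simp [hy, abs_mul, abs_of_pos (zero_lt_one.trans hr)]
    rw [h1]
    refine (Finset.abs_sum_le_sum_abs _ _).trans (Finset.sum_le_sum fun k _ => ?_)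
    rw [abs_mul, abs_of_pos (hM j k)]
  have hpow : ∀ n j, r ^ n * M.mulVec y j ≤ (M ^ (n + 1)).mulVec y j := by
    intro n
    induction n with
    | zero => intro j; simp
    | succ n ih =>
      intro j
      rw [pow_succ' M, ← Matrix.mulVec_mulVec]
      calc r ^ (n + 1) * M.mulVec y j = ∑ k, M j k * (r ^ n * (r * y k)) := by
            simp only [Matrix.mulVec, dotProduct]
            rw [Finset.mul_sum]
            exact Finset.sum_congr rfl fun k _ => by ring
        _ ≤ ∑ k, M j k * (M ^ (n + 1)).mulVec y k :=
            Finset.sum_le_sum fun k _ => mul_le_mul_of_nonneg_left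
              ((mul_le_mul_of_nonneg_left (hy1 k) (by positivity)).trans (ih k)) (hM j k).le
  have hi : 0 < M.mulVec y i := mulVec_pos hM (fun j => abs_nonneg _) hy0 i
  -- The mass of row `i` of `M ^ (n + 1)` returns to `i` in one more step.
  have hret : ∀ n, (∑ j, y j / M j i) * (M ^ (n + 2)) i i ≥ (M ^ (n + 1)).mulVec y i := by
    intro n
    rw [Finset.sum_mul]
    refine Finset.sum_le_sum fun j _ => ?_
    rw [div_mul_eq_mul_div, le_div_iff₀ (hM j i), mul_right_comm, mul_comm]
    refine mul_le_mul_of_nonneg_left ?_ (abs_nonneg _)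
    rw [pow_succ M (n + 1), Matrix.mul_apply]
    exact Finset.single_le_sum (f := fun k => (M ^ (n + 1)) i k * M k i) (fun k _ => mul_nonneg
      (pow_nonneg_apply (fun i j => (hM i j).le) _ i k) (hM k i).le) (Finset.mem_univ j)
  have hc : 0 ≤ ∑ j, y j / M j i :=
    Finset.sum_nonneg fun j _ => div_nonneg (abs_nonneg _) (hM j i).le
  have hlim : Tendsto (fun n : ℕ => r ^ n * M.mulVec y i) atTop atTop :=
    (tendsto_pow_atTop_atTop_of_one_lt hr).atTop_mul_const hi
  obtain ⟨n, hn⟩ := (hlim.eventually (eventually_gt_atTop (∑ j, y j / M j i))).exists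
  refine ⟨n + 2, ?_⟩
  by_contra! hle
  have := (hpow n i).trans (hret n)
  nlinarith [mul_le_mul_of_nonneg_left hle hc]

end PositiveMatrix

/-! ### Laws of path sums -/

section PathMeasure

variable {b : ℕ} (μ : Fin b → Fin b → Measure ℝ)

/-- The sum over all colour sequences `i = i₀, i₁, …, iₙ = j` of the laws of sums of independent
variables with laws `μ i₀ i₁, …, μ iₙ₋₁ iₙ`. -/
def pathMeasure : ℕ → Fin b → Fin b → Measure ℝ
  | 0, i, j => if i = j then Measure.dirac 0 else 0
  | n + 1, i, j => ∑ l, (pathMeasure n i l).conv (μ l j)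

variable [∀ i j, IsFiniteMeasure (μ i j)]

instance isFiniteMeasure_pathMeasure (n : ℕ) (i j : Fin b) :
    IsFiniteMeasure (pathMeasure μ n i j) := by
  induction n generalizing j with
  | zero => unfold pathMeasure; split_ifs <;> infer_instance
  | succ n ih => unfold pathMeasure; infer_instance

lemma conv_finset_sum {ι : Type*} (t : Finset ι) (ν : Measure ℝ) [IsFiniteMeasure ν]
    (ρ : ι → Measure ℝ) [∀ i, IsFiniteMeasure (ρ i)] :
    ν.conv (∑ i ∈ t, ρ i) = ∑ i ∈ t, ν.conv (ρ i) := by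
  classical
  induction t using Finset.induction_on with
  | empty => simp
  | insert i t hi ih =>
    rw [Finset.sum_insert hi, Finset.sum_insert hi, Measure.conv_add, ih]

lemma finset_sum_conv {ι : Type*} (t : Finset ι) (ν : Measure ℝ) [IsFiniteMeasure ν]
    (ρ : ι → Measure ℝ) [∀ i, IsFiniteMeasure (ρ i)] :
    (∑ i ∈ t, ρ i).conv ν = ∑ i ∈ t, (ρ i).conv ν := by
  classical
  induction t using Finset.induction_on with
  | empty => simp
  | insert i t hi ih =>
    rw [Finset.sum_insert hi, Finset.sum_insert hi, Measure.add_conv, ih]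

lemma measure_finset_sum_le {ι : Type*} (t : Finset ι) {ρ ρ' : ι → Measure ℝ}
    (h : ∀ i ∈ t, ρ i ≤ ρ' i) : ∑ i ∈ t, ρ i ≤ ∑ i ∈ t, ρ' i := by
  refine Measure.le_iff.2 fun s _ => ?_
  simp only [Measure.finsetSum_apply]
  exact Finset.sum_le_sum fun i hi => h i hi s

lemma pathMeasure_conv_le (n m : ℕ) (i l j : Fin b) :
    (pathMeasure μ n i l).conv (pathMeasure μ m l j) ≤ pathMeasure μ (n + m) i j := by
  induction m generalizing j with
  | zero =>
    simp only [pathMeasure, add_zero]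
    split_ifs with h
    · rw [Measure.conv_dirac_zero, h]
    · rw [Measure.conv_zero]
      exact Measure.zero_le _
  | succ m ih =>
    rw [← add_assoc, pathMeasure, pathMeasure, conv_finset_sum]
    refine measure_finset_sum_le _ fun p _ => ?_
    rw [← Measure.conv_assoc]
    exact conv_mono (ih p) le_rfl

lemma single_le_finset_sum {ι : Type*} {t : Finset ι} (ρ : ι → Measure ℝ) {i : ι} (hi : i ∈ t) :
    ρ i ≤ ∑ j ∈ t, ρ j := by
  refine Measure.le_iff.2 fun s _ => ?_
  rw [Measure.finsetSum_apply]
  exact Finset.single_le_sum (f := fun j => ρ j s) (fun _ _ => zero_le) hi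

lemma le_pathMeasure_one (i j : Fin b) : μ i j ≤ pathMeasure μ 1 i j := by
  have h : (pathMeasure μ 0 i i).conv (μ i j) = μ i j := by
    rw [pathMeasure, if_pos rfl, Measure.dirac_zero_conv]
  conv_lhs => rw [← h]
  exact single_le_finset_sum (fun l => (pathMeasure μ 0 i l).conv (μ l j)) (Finset.mem_univ i)

lemma convPow_pathMeasure_le (n k : ℕ) (i : Fin b) :
    convPow (pathMeasure μ n i i) k ≤ pathMeasure μ (n * k) i i := by
  induction k with
  | zero => simp [convPow, pathMeasure]
  | succ k ih =>
    rw [convPow, mul_add, mul_one]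
    exact (conv_mono ih le_rfl).trans (pathMeasure_conv_le μ _ _ _ _ _)

lemma laplace_pathMeasure {s : ℝ} {M : Matrix (Fin b) (Fin b) ℝ} (hM : ∀ i j, 0 ≤ M i j)
    (h : ∀ i j, laplace s (μ i j) = ENNReal.ofReal (M i j)) (n : ℕ) (i j : Fin b) :
    laplace s (pathMeasure μ n i j) = ENNReal.ofReal ((M ^ n) i j) := by
  induction n generalizing j with
  | zero =>
    rw [pathMeasure, pow_zero, Matrix.one_apply]
    split_ifs
    · rw [laplace_dirac_zero, ENNReal.ofReal_one]
    · simp [laplace]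
  | succ n ih =>
    rw [pathMeasure, laplace_finset_sum, pow_succ, Matrix.mul_apply,
      ENNReal.ofReal_sum_of_nonneg fun k _ => mul_nonneg (pow_nonneg_apply hM n i k) (hM k j)]
    refine Finset.sum_congr rfl fun l _ => ?_
    rw [laplace_conv, ih, h, ENNReal.ofReal_mul (pow_nonneg_apply hM n i l)]

lemma exists_one_lt_laplace_of_eigenvalue {s : ℝ} {M : Matrix (Fin b) (Fin b) ℝ}
    (hM : ∀ i j, 0 < M i j) (h : ∀ i j, laplace s (μ i j) = ENNReal.ofReal (M i j)) {r : ℝ}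
    (hr : 1 < r) (hMr : Module.End.HasEigenvalue (Matrix.toLin' M) r) (i : Fin b) :
    ∃ n, 1 < laplace s (pathMeasure μ n i i) := by
  obtain ⟨n, hn⟩ := exists_one_lt_pow_diag hM hr hMr i
  refine ⟨n, ?_⟩
  rw [laplace_pathMeasure μ (fun i j => (hM i j).le) h, ← ENNReal.ofReal_one]
  exact (ENNReal.ofReal_lt_ofReal_iff (zero_lt_one.trans hn)).2 hn

/-- An infinite moment `𝔼 ξ_{kl}^s` makes the Laplace transform of the closed path
`i → k → l → i` infinite. -/
lemma exists_one_lt_laplace_of_eq_top {s : ℝ} (hμ : ∀ i j, μ i j ≠ 0) {k l : Fin b}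
    (h : laplace s (μ k l) = ∞) (i : Fin b) :
    ∃ n, 1 < laplace s (pathMeasure μ n i i) := by
  refine ⟨1 + 1 + 1, ?_⟩
  have h1 : ((μ i k).conv (μ k l)).conv (μ l i) ≤ pathMeasure μ (1 + 1 + 1) i i :=
    (conv_mono ((conv_mono (le_pathMeasure_one μ i k) (le_pathMeasure_one μ k l)).trans
      (pathMeasure_conv_le μ 1 1 i k l)) (le_pathMeasure_one μ l i)).trans
      (pathMeasure_conv_le μ (1 + 1) 1 i l i)
  refine lt_of_lt_of_le ?_ (laplace_mono s h1)
  rw [laplace_conv, laplace_conv, h, ENNReal.mul_top (laplace_ne_zero s (hμ i k)),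
    ENNReal.top_mul (laplace_ne_zero s (hμ l i))]
  exact ENNReal.one_lt_top

/-- If, for every `s ≥ 0`, the transform of some closed path measure exceeds `1`, and if closed
paths can have a positive sum, then for one length `n` the expected number of closed paths with
sum above some `θ > 0` exceeds `1`. Compactness in `s` gives one length for all `s`. -/
theorem exists_one_lt_pathMeasure (i : Fin b)
    (h1 : ∀ s, 0 ≤ s → ∃ n, 1 < laplace s (pathMeasure μ n i i))
    (h2 : ∃ k, 0 < pathMeasure μ k i i (Set.Ioi 0)) :
    ∃ n : ℕ, ∃ θ : ℝ, 0 < θ ∧ 1 < pathMeasure μ n i i (Set.Ioi θ) := by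
  have hpow : ∀ (s : ℝ) (n k : ℕ), k ≠ 0 → 1 < laplace s (pathMeasure μ n i i) →
      1 < laplace s (pathMeasure μ (n * k) i i) := by
    intro s n k hk h
    refine lt_of_lt_of_le ?_ (laplace_mono s (convPow_pathMeasure_le μ n k i))
    rw [laplace_convPow]
    exact one_lt_pow₀ h hk
  have hzero : ∀ s, laplace s (pathMeasure μ 0 i i) = 1 := fun s => by
    rw [pathMeasure, if_pos rfl, laplace_dirac_zero]
  obtain ⟨k₀, hk₀⟩ := h2
  have hk0 : k₀ ≠ 0 := by
    rintro rfl
    simp [pathMeasure] at hk₀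
  obtain ⟨S, hS, hSlt⟩ := exists_le_laplace hk₀ 1
  rw [ENNReal.ofReal_one] at hSlt
  obtain ⟨N, hN⟩ := (isCompact_Icc (a := (0 : ℝ)) (b := S)).elim_directed_cover
    (fun n : ℕ => {s : ℝ | 1 < laplace s (pathMeasure μ n.factorial i i)})
    (fun n => isOpen_one_lt_laplace _)
    (fun s hs => by
      obtain ⟨n, hn⟩ := h1 s hs.1
      have hn0 : n ≠ 0 := by
        rintro rfl
        exact hn.ne' (hzero s)
      refine Set.mem_iUnion.2 ⟨n, ?_⟩
      obtain ⟨k, hk⟩ := Nat.dvd_factorial (Nat.pos_of_ne_zero hn0) le_rfl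
      show 1 < laplace s (pathMeasure μ n.factorial i i)
      rw [hk]
      refine hpow s n k ?_ hn
      rintro rfl
      exact n.factorial_ne_zero (by simpa using hk))
    (Monotone.directed_le fun n m hnm s hs => by
      obtain ⟨k, hk⟩ := Nat.factorial_dvd_factorial hnm
      show 1 < laplace s (pathMeasure μ m.factorial i i)
      rw [hk]
      refine hpow s _ k ?_ hs
      rintro rfl
      exact m.factorial_ne_zero (by simpa using hk))
  set n := k₀ * N.factorial
  have hall : ∀ s, 0 ≤ s → 1 < laplace s (pathMeasure μ n i i) := by
    intro s hs
    rcases le_total s S with hsS | hsS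
    · have : n = N.factorial * k₀ := mul_comm _ _
      rw [this]
      exact hpow s _ _ hk0 (hN ⟨hs, hsS⟩)
    · exact hpow s _ _ N.factorial_ne_zero (hSlt s hsS)
  have hpos : 0 < pathMeasure μ n i i (Set.Ioi 0) := by
    refine lt_of_lt_of_le ?_ (convPow_pathMeasure_le μ k₀ N.factorial i _)
    have : ∀ k, 0 < convPow (pathMeasure μ k₀ i i) (k + 1) (Set.Ioi 0) := by
      intro k
      induction k with
      | zero => rwa [convPow, convPow, Measure.dirac_zero_conv]
      | succ k ih =>
        rw [convPow]
        have := mul_Ioi_le_conv_Ioi (convPow (pathMeasure μ k₀ i i) (k + 1))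
          (pathMeasure μ k₀ i i) 0 0
        rw [add_zero] at this
        exact (ENNReal.mul_pos ih.ne' hk₀.ne').trans_le this
    obtain ⟨k, hk⟩ := Nat.exists_eq_succ_of_ne_zero N.factorial_ne_zero
    rw [hk]
    exact this k
  obtain ⟨k, -, θ, hθ, hlt⟩ := exists_one_lt_convPow hall hpos
  exact ⟨n * k, θ, hθ, hlt.trans_le (convPow_pathMeasure_le μ n k i _)⟩

/-- If path sums from `i` are unbounded, then closed paths at `i` can have a positive sum: a
single step back to `i` costs only a bounded amount with positive probability. -/
lemma exists_pos_pathMeasure (hμ : ∀ i j, μ i j ≠ 0) (i : Fin b)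
    (h : ∀ T : ℝ, ∃ n j, 0 < pathMeasure μ n i j (Set.Ioi T)) :
    ∃ k, 0 < pathMeasure μ k i i (Set.Ioi 0) := by
  have hT : ∀ j, ∃ T : ℝ, 0 < μ j i (Set.Ioi (-T)) := by
    intro j
    by_contra! hcon
    refine hμ j i (Measure.measure_univ_eq_zero.1 ?_)
    have hU : (Set.univ : Set ℝ) = ⋃ n : ℕ, Set.Ioi (-(n : ℝ)) := by
      refine (Set.eq_univ_of_forall fun x => Set.mem_iUnion.2 ?_).symm
      obtain ⟨n, hn⟩ := exists_nat_gt (-x)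
      exact ⟨n, Set.mem_Ioi.2 (by linarith)⟩
    rw [hU]
    exact measure_iUnion_null fun n => le_antisymm (hcon n) (zero_le)
  choose T hT using hT
  obtain ⟨n, j, hnj⟩ := h (∑ j, |T j|)
  refine ⟨n + 1, lt_of_lt_of_le ?_ ((pathMeasure_conv_le μ n 1 i j i).trans' (conv_mono le_rfl
    (le_pathMeasure_one μ j i)) _)⟩
  have hle : T j ≤ ∑ j, |T j| := (le_abs_self _).trans
    (Finset.single_le_sum (f := fun j => |T j|) (fun _ _ => abs_nonneg _) (Finset.mem_univ j))
  refine (ENNReal.mul_pos hnj.ne' (hT j).ne').trans_le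
    ((mul_Ioi_le_conv_Ioi _ _ _ _).trans (measure_mono (Set.Ioi_subset_Ioi ?_)))
  linarith

end PathMeasure

/-! ### Words and colourings -/

section Words

variable {b : ℕ}

/-- The words of length `n`, that is, the vertices at level `n`. -/
def words (b : ℕ) : ℕ → Finset (Vertex b)
  | 0 => {[]}
  | n + 1 => (words b n ×ˢ Finset.univ).image fun p => p.2 :: p.1

lemma mem_words {n : ℕ} {w : Vertex b} : w ∈ words b n ↔ w.length = n := by
  induction n generalizing w with
  | zero => simp [words]
  | succ n ih =>
    cases w with
    | nil => simp [words]
    | cons i w => simp [words, ih]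

lemma sum_words_succ {A : Type*} [AddCommMonoid A] (n : ℕ) (g : Vertex b → A) :
    ∑ w ∈ words b (n + 1), g w = ∑ w ∈ words b n, ∑ i, g (i :: w) := by
  rw [words, Finset.sum_image, Finset.sum_product]
  rintro ⟨w, i⟩ - ⟨w', i'⟩ - h
  simp only [List.cons.injEq] at h
  exact Prod.ext h.2 h.1

lemma card_words (n : ℕ) : (words b n).card = b ^ n := by
  induction n with
  | zero => simp [words]
  | succ n ih =>
    have := sum_words_succ (b := b) n (fun _ => (1 : ℕ))
    simpa [ih, pow_succ] using this

/-- Among the children of a vertex every colour occurs exactly once. -/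
lemma IsProper.sum_children {κ : Vertex b → Fin b} (hκ : IsProper κ) {A : Type*} [AddCommMonoid A]
    (v : Vertex b) (h : Fin b → A) : ∑ i, h (κ (i :: v)) = ∑ j, h j :=
  (Finite.injective_iff_bijective.1 (hκ v)).sum_comp h

end Words

/-! ### Sums of labels along paths, for a fixed colouring -/

section Quenched

variable {b : ℕ} {Ω : Type*}

/-- The sum of the labels `η` along the path from the vertex `l` to its descendant `w ++ l`. -/
def pathSum (η : Vertex b → Fin b → Ω → ℝ) (l : Vertex b) : Vertex b → Ω → ℝ
  | [], _ => 0
  | i :: w, ω => pathSum η l w ω + η (w ++ l) i ω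

/-- The law of the sum along the path from `l` to `w ++ l` when the labels of the edges are
independent with the laws given by `μ` and the colouring `κ`. -/
def pathLaw (μ : Fin b → Fin b → Measure ℝ) (κ : Vertex b → Fin b) (l : Vertex b) :
    Vertex b → Measure ℝ
  | [] => Measure.dirac 0
  | i :: w => (pathLaw μ κ l w).conv (μ (κ (w ++ l)) (κ (i :: (w ++ l))))

lemma pathSum_append (η : Vertex b → Fin b → Ω → ℝ) (l w w' : Vertex b) (ω : Ω) :
    pathSum η l (w' ++ w) ω = pathSum η l w ω + pathSum η (w ++ l) w' ω := by
  induction w' with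
  | nil => simp [pathSum]
  | cons i w' ih => simp [pathSum, ih, add_assoc]

variable (μ : Fin b → Fin b → Measure ℝ)

instance isFiniteMeasure_pathLaw [∀ i j, IsFiniteMeasure (μ i j)] (κ : Vertex b → Fin b)
    (l w : Vertex b) : IsFiniteMeasure (pathLaw μ κ l w) := by
  induction w with
  | nil => unfold pathLaw; infer_instance
  | cons i w ih => unfold pathLaw; infer_instance

/-- In a proper colouring the `b` children of a vertex carry the `b` colours, so the sum of the
path laws over all descendants of given depth and colour does not depend on the colouring. -/
lemma IsProper.sum_pathLaw [∀ i j, IsFiniteMeasure (μ i j)] {κ : Vertex b → Fin b}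
    (hκ : IsProper κ) (l : Vertex b) (n : ℕ) (j : Fin b) :
    ∑ w ∈ words b n, (if κ (w ++ l) = j then pathLaw μ κ l w else 0)
      = pathMeasure μ n (κ l) j := by
  induction n generalizing j with
  | zero => simp [words, pathMeasure, pathLaw]
  | succ n ih =>
    have h1 : ∀ w : Vertex b, ∑ i, (if κ (i :: w ++ l) = j then pathLaw μ κ l (i :: w) else 0)
        = (pathLaw μ κ l w).conv (μ (κ (w ++ l)) j) := by
      intro w
      have := hκ.sum_children (w ++ l)
        (fun c => if c = j then (pathLaw μ κ l w).conv (μ (κ (w ++ l)) c) else 0)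
      simpa [pathLaw] using this
    have h2 : ∀ c, IsFiniteMeasure (∑ w ∈ words b n,
        (if κ (w ++ l) = c then pathLaw μ κ l w else 0)) := fun c => by
      rw [ih]; infer_instance
    have h3 : ∀ c w, IsFiniteMeasure (if κ (w ++ l) = c then pathLaw μ κ l w else 0) :=
      fun c w => by split_ifs <;> infer_instance
    rw [sum_words_succ, pathMeasure]
    simp_rw [h1, ← ih]
    rw [Finset.sum_congr rfl fun c _ => finset_sum_conv (words b n) (μ c j) _, Finset.sum_comm]
    refine Finset.sum_congr rfl fun w _ => ?_
    rw [Finset.sum_eq_single (κ (w ++ l))]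
    · simp
    · intro c _ hc
      simp [Ne.symm hc]
    · simp

lemma IsProper.pathLaw_le [∀ i j, IsFiniteMeasure (μ i j)] {κ : Vertex b → Fin b}
    (hκ : IsProper κ) (l w : Vertex b) :
    pathLaw μ κ l w ≤ pathMeasure μ w.length (κ l) (κ (w ++ l)) := by
  rw [← hκ.sum_pathLaw μ l w.length (κ (w ++ l))]
  have := single_le_finset_sum
    (fun w' => if κ (w' ++ l) = κ (w ++ l) then pathLaw μ κ l w' else 0)
    (mem_words.2 rfl : w ∈ words b w.length)
  simpa using this

/-- The `σ`-algebra of the labels of the edges from `u` to `f u :: u`, `u ∈ T`. -/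
@[reducible] def edgeSigma (η : Vertex b → Fin b → Ω → ℝ) (f : Vertex b → Fin b)
    (T : Set (Vertex b)) : MeasurableSpace Ω :=
  ⨆ u ∈ T, MeasurableSpace.comap (η u (f u)) inferInstance

lemma edgeSigma_mono (η : Vertex b → Fin b → Ω → ℝ) {f g : Vertex b → Fin b}
    {S T : Set (Vertex b)} (h : S ⊆ T) (hfg : ∀ u ∈ S, f u = g u) :
    edgeSigma η f S ≤ edgeSigma η g T := by
  refine iSup₂_le fun u hu => ?_
  rw [hfg u hu]
  exact le_iSup₂ (f := fun u (_ : u ∈ T) => MeasurableSpace.comap (η u (g u)) inferInstance)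
    u (h hu)

/-- `f` selects, at every vertex of the path from `l` to `w ++ l`, the next edge of this path. -/
def Follows (f : Vertex b → Fin b) (l : Vertex b) : Vertex b → Prop
  | [] => True
  | i :: w => f (w ++ l) = i ∧ Follows f l w

lemma Follows.congr {f g : Vertex b → Fin b} {l : Vertex b} {w : Vertex b} (h : Follows f l w)
    (hfg : ∀ y : Vertex b, y.length < w.length → f (y ++ l) = g (y ++ l)) : Follows g l w := by
  induction w with
  | nil => trivial
  | cons i w ih =>
    exact ⟨(hfg w (by simp)).symm.trans h.1, ih h.2 fun y hy => hfg y (by simp; omega)⟩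

lemma exists_follows (f : Vertex b → Fin b) (l w : Vertex b) :
    ∃ g, Follows g l w ∧ ∀ u, ¬ l <:+ u → g u = f u := by
  classical
  induction w with
  | nil => exact ⟨f, trivial, fun _ _ => rfl⟩
  | cons i w ih =>
    obtain ⟨g, hg, hgf⟩ := ih
    refine ⟨Function.update g (w ++ l) i, ⟨by simp, hg.congr fun y hy => ?_⟩, fun u hu => ?_⟩
    · rw [Function.update_of_ne]
      intro h
      rw [List.append_cancel_right h] at hy
      exact lt_irrefl _ hy
    · rw [Function.update_of_ne, hgf u hu]
      rintro rfl
      exact hu (List.suffix_append _ _)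

lemma measurable_pathSum_edgeSigma (η : Vertex b → Fin b → Ω → ℝ) {f : Vertex b → Fin b}
    {l w : Vertex b} (h : Follows f l w) :
    Measurable[edgeSigma η f {u | l <:+ u ∧ u.length < w.length + l.length}]
      (pathSum η l w) := by
  induction w with
  | nil => exact measurable_const
  | cons i w ih =>
    have h1 : Measurable[edgeSigma η f {u | l <:+ u ∧ u.length < (i :: w).length + l.length}]
        (pathSum η l w) := by
      refine (ih h.2).mono (edgeSigma_mono η ?_ fun _ _ => rfl) le_rfl
      rintro u ⟨h1, h2⟩
      exact ⟨h1, h2.trans (by simp)⟩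
    have h2 : Measurable[edgeSigma η f {u | l <:+ u ∧ u.length < (i :: w).length + l.length}]
        (η (w ++ l) i) := by
      rw [measurable_iff_comap_le]
      have := le_iSup₂ (f := fun u (_ : u ∈ {u | l <:+ u ∧ u.length < (i :: w).length + l.length})
        => MeasurableSpace.comap (η u (f u)) inferInstance) (w ++ l)
        ⟨List.suffix_append _ _, by simp⟩
      rwa [h.1] at this
    exact h1.add h2

variable [MeasurableSpace Ω]

/-- The labels `η` for a fixed colouring `κ`: labels of edges below level `N` with distinct parent
endpoints are independent, and the edge from `u` to `v` has the law `μ (κ u) (κ v)`. -/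
structure IsQuenched (Q : Measure Ω) (μ : Fin b → Fin b → Measure ℝ) (κ : Vertex b → Fin b)
    (η : Vertex b → Fin b → Ω → ℝ) (N : ℕ) : Prop where
  measurable : ∀ v i, Measurable (η v i)
  law : ∀ (s : Finset (Vertex b)) (f : Vertex b → Fin b) (A : Vertex b → Set ℝ),
    (∀ u ∈ s, u.length < N) → (∀ u ∈ s, MeasurableSet (A u)) →
    Q {ω | ∀ u ∈ s, η u (f u) ω ∈ A u} = ∏ u ∈ s, μ (κ u) (κ (f u :: u)) (A u)

variable {μ} {Q : Measure Ω} {κ : Vertex b → Fin b} {η : Vertex b → Fin b → Ω → ℝ} {N : ℕ}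

lemma measurable_pathSum (hη : ∀ v i, Measurable (η v i)) (l w : Vertex b) :
    Measurable (pathSum η l w) := by
  induction w with
  | nil => exact measurable_const
  | cons i w ih => exact ih.add (hη _ _)

lemma IsQuenched.isProbabilityMeasure (hQ : IsQuenched Q μ κ η N) :
    IsProbabilityMeasure Q :=
  ⟨by simpa using hQ.law ∅ κ (fun _ => Set.univ) (by simp) (by simp)⟩

lemma IsQuenched.indep_edgeSigma (hQ : IsQuenched Q μ κ η N)
    (f : Vertex b → Fin b) {S T : Set (Vertex b)} (hS : ∀ u ∈ S, u.length < N)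
    (hT : ∀ u ∈ T, u.length < N) (hST : Disjoint S T) :
    ProbabilityTheory.Indep (edgeSigma η f S) (edgeSigma η f T) Q := by
  classical
  have hind : ProbabilityTheory.iIndepFun
      (fun u : {u : Vertex b // u.length < N} => η u.1 (f u.1)) Q := by
    rw [ProbabilityTheory.iIndepFun_iff_measure_inter_preimage_eq_mul]
    intro s A hA
    have key : ∀ (t : Finset (Vertex b)) (B : Vertex b → Set ℝ), (∀ u ∈ t, u.length < N) →
        (∀ u ∈ t, MeasurableSet (B u)) →
        Q {ω | ∀ u ∈ t, η u (f u) ω ∈ B u} = ∏ u ∈ t, Q {ω | η u (f u) ω ∈ B u} := by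
      intro t B ht hB
      rw [hQ.law t f B ht hB]
      refine Finset.prod_congr rfl fun u hu => ?_
      have := hQ.law {u} f B (by simpa using ht u hu) (by simpa using hB u hu)
      simpa using this.symm
    let B : Vertex b → Set ℝ := fun u => if h : u.length < N then A ⟨u, h⟩ else Set.univ
    have hB : ∀ u : {u : Vertex b // u.length < N}, B u.1 = A u := fun u => by
      simp [B, u.2]
    have := key (s.map (Function.Embedding.subtype _)) B
      (fun u hu => by
        obtain ⟨v, -, rfl⟩ := Finset.mem_map.1 hu
        exact v.2)
      (fun u hu => by
        obtain ⟨v, hv, rfl⟩ := Finset.mem_map.1 hu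
        exact (hB v).symm ▸ hA v hv)
    rw [Finset.prod_map] at this
    refine Eq.trans ?_ (this.trans (Finset.prod_congr rfl fun u _ => ?_))
    · congr 1
      ext ω
      simp only [Set.mem_iInter, Set.mem_preimage, Set.mem_ofPred_eq, Finset.mem_map,
        Function.Embedding.subtype_apply]
      constructor
      · rintro h _ ⟨v, hv, rfl⟩
        exact (hB v).symm ▸ h v hv
      · intro h u hu
        exact hB u ▸ h u ⟨u, hu, rfl⟩
    · rw [Function.Embedding.subtype_apply, hB u]
      rfl
  have h := ProbabilityTheory.indep_iSup_of_disjoint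
    (m := fun u : {u : Vertex b // u.length < N} =>
      MeasurableSpace.comap (η u.1 (f u.1)) inferInstance)
    (fun u => (hQ.measurable _ _).comap_le) hind (S := Subtype.val ⁻¹' S) (T := Subtype.val ⁻¹' T)
    (Disjoint.preimage _ hST)
  have hle : ∀ R : Set (Vertex b), (∀ u ∈ R, u.length < N) → edgeSigma η f R ≤
      ⨆ u ∈ (Subtype.val ⁻¹' R : Set {u : Vertex b // u.length < N}),
        MeasurableSpace.comap (η u.1 (f u.1)) inferInstance := by
    intro R hR
    refine iSup₂_le fun u hu => ?_
    exact le_iSup₂ (f := fun (u : {u : Vertex b // u.length < N})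
      (_ : u ∈ (Subtype.val ⁻¹' R : Set {u : Vertex b // u.length < N})) =>
        MeasurableSpace.comap (η u.1 (f u.1)) inferInstance) ⟨u, hR u hu⟩ hu
  exact ProbabilityTheory.indep_of_indep_of_le_left
    (ProbabilityTheory.indep_of_indep_of_le_right h (hle T hT)) (hle S hS)

lemma IsQuenched.map_label (hQ : IsQuenched Q μ κ η N) {u : Vertex b} (hu : u.length < N)
    (i : Fin b) : Q.map (η u i) = μ (κ u) (κ (i :: u)) := by
  ext A hA
  rw [Measure.map_apply (hQ.measurable u i) hA]
  have := hQ.law {u} (fun _ => i) (fun _ => A) (by simpa using hu) (by simpa using hA)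
  simpa using! this

lemma IsQuenched.map_pathSum (hQ : IsQuenched Q μ κ η N) {l w : Vertex b}
    (hN : w.length + l.length ≤ N) : Q.map (pathSum η l w) = pathLaw μ κ l w := by
  have := hQ.isProbabilityMeasure
  induction w with
  | nil =>
    have : pathSum η l [] = fun _ : Ω => (0 : ℝ) := rfl
    rw [this, pathLaw, Measure.map_const, measure_univ, one_smul]
  | cons i w ih =>
    have hlen : w.length + l.length < N := by
      simp only [List.length_cons] at hN
      omega
    obtain ⟨f, hf, -⟩ := exists_follows κ l (i :: w)
    have hind : ProbabilityTheory.IndepFun (pathSum η l w) (η (w ++ l) i) Q := by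
      rw [ProbabilityTheory.IndepFun_iff_Indep]
      refine ProbabilityTheory.indep_of_indep_of_le_left
        (ProbabilityTheory.indep_of_indep_of_le_right (hQ.indep_edgeSigma f
          (S := {u | l <:+ u ∧ u.length < w.length + l.length}) (T := {w ++ l}) ?_ ?_ ?_) ?_) ?_
      · exact fun u hu => hu.2.trans hlen
      · rintro u rfl
        simpa using hlen
      · rw [Set.disjoint_singleton_right]
        rintro ⟨-, h⟩
        simp at h
      · have := le_iSup₂ (f := fun u (_ : u ∈ ({w ++ l} : Set (Vertex b)))
          => MeasurableSpace.comap (η u (f u)) inferInstance) (w ++ l) rfl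
        rwa [hf.1] at this
      · exact (measurable_pathSum_edgeSigma η hf.2).comap_le
    have h := hind.map_add_eq_map_conv_map (measurable_pathSum hQ.measurable l w)
      (hQ.measurable _ _)
    rw [ih hlen.le, hQ.map_label (by simpa using hlen)] at h
    exact h

end Quenched

/-! ### From the random colouring to a fixed one -/

section Colouring

variable {b : ℕ}

lemma measurableSet_agreeUpTo {Ω : Type*} (c : Ω → Vertex b → Fin b)
    (κ : Vertex b → Fin b) (n : ℕ) :
    MeasurableSet[MeasurableSpace.comap c inferInstance] (agreeUpTo c κ n) := by
  refine ⟨{k | ∀ v : Vertex b, v.length ≤ n → k v = κ v}, ?_, rfl⟩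
  have : {k : Vertex b → Fin b | ∀ v : Vertex b, v.length ≤ n → k v = κ v}
      = ⋂ v : Vertex b, ⋂ _ : v.length ≤ n, {k | k v = κ v} := by
    ext k; simp
  rw [this]
  exact MeasurableSet.iInter fun v => MeasurableSet.iInter fun _ =>
    measurableSet_eq_fun (measurable_pi_apply v) measurable_const

/-- The vertices at the levels `0, …, n - 1`. -/
def wordsLT (b n : ℕ) : Finset (Vertex b) := (Finset.range n).biUnion (words b)

lemma mem_wordsLT {n : ℕ} {v : Vertex b} : v ∈ wordsLT b n ↔ v.length < n := by
  simp [wordsLT, mem_words]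

lemma card_wordsLT (n : ℕ) : (wordsLT b n).card = ∑ l ∈ Finset.range n, b ^ l := by
  rw [wordsLT, Finset.card_biUnion]
  · simp [card_words]
  · intro i _ j _ hij
    refine Finset.disjoint_left.2 fun w hi hj => hij ?_
    rw [← mem_words.1 hi, ← mem_words.1 hj]

end Colouring

section Environment

variable {b : ℕ} {Ω Ω' : Type*} [MeasurableSpace Ω] [MeasurableSpace Ω'] {P : Measure Ω}
  {P' : Measure Ω'} {ξ : Fin b → Fin b → Ω' → ℝ} {α : Fin b} {c : Ω → Vertex b → Fin b}
  {ζ : Vertex b → Fin b → Ω → ℝ}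

/-- The law of `log ξ_{ij}`. -/
def logLaw (P' : Measure Ω') (ξ : Fin b → Fin b → Ω' → ℝ) (i j : Fin b) : Measure ℝ :=
  P'.map fun ω => Real.log (ξ i j ω)

/-- The logarithms of the edge labels. -/
def logLabel (ζ : Vertex b → Fin b → Ω → ℝ) (v : Vertex b) (i : Fin b) (ω : Ω) : ℝ :=
  Real.log (ζ v i ω)

instance isFiniteMeasure_logLaw [IsFiniteMeasure P'] (i j : Fin b) :
    IsFiniteMeasure (logLaw P' ξ i j) := by
  unfold logLaw; infer_instance

lemma IsRandomEnvironment.measure_agreeUpTo [IsProbabilityMeasure P]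
    (henv : IsRandomEnvironment P P' ξ α c ζ) {κ : Vertex b → Fin b} (hκ : IsProper κ)
    (hα : κ [] = α) (n : ℕ) :
    P (agreeUpTo c κ n) = (((b.factorial ^ (wordsLT b n).card : ℕ) : ℝ≥0∞))⁻¹ := by
  induction n with
  | zero =>
    have h1 : agreeUpTo c κ 0 =ᵐ[P] Set.univ := by
      refine eventuallyEq_univ.2 ?_
      filter_upwards [henv.root_colour] with ω hω v hv
      rw [List.length_eq_zero_iff.1 (Nat.le_zero.1 hv), hω, hα]
    rw [measure_congr h1]
    simp [card_wordsLT]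
  | succ n ih =>
    rw [henv.uniform_colour n κ hκ, ih, card_wordsLT, card_wordsLT, Finset.sum_range_succ, pow_add,
      Nat.cast_mul, ENNReal.mul_inv (by simp) (by simp), div_eq_mul_inv]

/-- The colouring is almost surely proper: up to level `n` there are as many proper colourings as
the inverse of the probability of each. -/
lemma IsRandomEnvironment.ae_isProper [IsProbabilityMeasure P]
    (henv : IsRandomEnvironment P P' ξ α c ζ) : ∀ᵐ ω ∂P, IsProper (c ω) ∧ c ω [] = α := by
  classical
  have key : ∀ n, ∀ᵐ ω ∂P, ∀ v : Vertex b, v.length < n →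
      Function.Injective fun i : Fin b => c ω (i :: v) := by
    intro n
    let col : (wordsLT b n → Equiv.Perm (Fin b)) → Vertex b → Fin b := fun f v =>
      match v with
      | [] => α
      | i :: v => if h : v ∈ wordsLT b n then f ⟨v, h⟩ i else i
    have hcol : ∀ f, IsProper (col f) := by
      intro f v
      by_cases h : v ∈ wordsLT b n
      · simpa [col, h] using (f ⟨v, h⟩).injective
      · simpa [col, h] using! Function.injective_id (α := Fin b)
    have hdisj : Pairwise (Function.onFun Disjoint fun f => agreeUpTo c (col f) n) := by
      intro f g hfg
      refine Set.disjoint_left.2 fun ω hf hg => hfg ?_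
      funext v
      refine Equiv.ext fun i => ?_
      have hv := mem_wordsLT.1 v.2
      have := (hf (i :: v.1) (by simpa using hv)).symm.trans (hg (i :: v.1) (by simpa using hv))
      simpa [col] using this
    have hmeas : ∀ f, MeasurableSet (agreeUpTo c (col f) n) := fun f =>
      henv.measurable_colour.comap_le _ (measurableSet_agreeUpTo c _ n)
    have htot : P (⋃ f, agreeUpTo c (col f) n) = 1 := by
      rw [measure_iUnion hdisj hmeas, tsum_fintype,
        Finset.sum_congr rfl fun f _ => henv.measure_agreeUpTo (hcol f) rfl n, Finset.sum_const,
        Finset.card_univ, Fintype.card_fun, Fintype.card_perm, Fintype.card_fin, Fintype.card_coe,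
        nsmul_eq_mul]
      exact ENNReal.mul_inv_cancel (by simpa using fun h => absurd h b.factorial_ne_zero) (by simp)
    have hae := (prob_compl_eq_zero_iff (MeasurableSet.iUnion hmeas)).2 htot
    filter_upwards [compl_mem_ae_iff.2 hae] with ω hω v hv i j hij
    rw [compl_compl] at hω
    obtain ⟨f, hf⟩ := Set.mem_iUnion.1 hω
    have hi := hf (i :: v) (by simpa using hv)
    have hj := hf (j :: v) (by simpa using hv)
    exact hcol f v (hi.symm.trans (Eq.trans hij hj))
  filter_upwards [ae_all_iff.2 key, henv.root_colour] with ω hω hα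
  exact ⟨fun v => hω (v.length + 1) v (Nat.lt_succ_self _), hα⟩

lemma IsRandomEnvironment.isQuenched [IsProbabilityMeasure P] [IsProbabilityMeasure P']
    (henv : IsRandomEnvironment P P' ξ α c ζ) (hξ : ∀ i j, Measurable (ξ i j))
    {κ : Vertex b → Fin b} {N : ℕ} (hpos : P (agreeUpTo c κ N) ≠ 0) :
    IsQuenched (ProbabilityTheory.cond P (agreeUpTo c κ N)) (logLaw P' ξ) κ (logLabel ζ) N := by
  refine ⟨fun v i => Real.measurable_log.comp (henv.measurable_label v i), ?_⟩
  intro s f A hs hA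
  have hGc := measurableSet_agreeUpTo c κ N
  have hG := henv.measurable_colour.comap_le _ hGc
  have hlaw := henv.label_law s f (fun u => Real.log ⁻¹' A u)
    fun u hu => Real.measurable_log (hA u hu)
  set E : Set Ω := {ω | ∀ u ∈ s, ζ u (f u) ω ∈ Real.log ⁻¹' A u} with hE
  have hEm : MeasurableSet E := by
    have : E = ⋂ u ∈ s, ζ u (f u) ⁻¹' (Real.log ⁻¹' A u) := by
      ext ω; simp [hE]
    rw [this]
    exact Finset.measurableSet_biInter s fun u hu =>
      henv.measurable_label u (f u) (Real.measurable_log (hA u hu))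
  have hint : Integrable (E.indicator fun _ => (1 : ℝ)) P :=
    (integrable_const 1).indicator hEm
  have h1 : P.real (E ∩ agreeUpTo c κ N)
      = P.real (agreeUpTo c κ N) * ∏ u ∈ s, (logLaw P' ξ (κ u) (κ (f u :: u))).real (A u) := by
    have h2 := setIntegral_condExp henv.measurable_colour.comap_le hint hGc
    rw [setIntegral_congr_ae (g := fun _ => ∏ u ∈ s,
      (logLaw P' ξ (κ u) (κ (f u :: u))).real (A u)) hG ?_, setIntegral_const,
      integral_indicator hEm, setIntegral_const, measureReal_restrict_apply hEm] at h2
    · simpa using h2.symm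
    · filter_upwards [hlaw] with ω hω hωG
      rw [hω]
      refine Finset.prod_congr rfl fun u hu => ?_
      have hu' := hs u hu
      rw [hωG u hu'.le, hωG (f u :: u) (by simpa using hu'), logLaw,
        map_measureReal_apply (f := fun ω => Real.log (ξ (κ u) (κ (f u :: u)) ω))
          (Real.measurable_log.comp (hξ _ _)) (hA u hu)]
      rfl
  have h3 : P (E ∩ agreeUpTo c κ N)
      = P (agreeUpTo c κ N) * ∏ u ∈ s, logLaw P' ξ (κ u) (κ (f u :: u)) (A u) := by
    rw [← ENNReal.toReal_eq_toReal_iff' (by simp)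
      (ENNReal.mul_ne_top (by simp) (ENNReal.prod_ne_top fun u _ => by simp)), ENNReal.toReal_mul,
      ENNReal.toReal_prod]
    exact h1
  rw [ProbabilityTheory.cond_apply hG, Set.inter_comm]
  change _ * P (E ∩ _) = _
  rw [h3, ← mul_assoc, ENNReal.inv_mul_cancel hpos (by simp), one_mul]

/-- A bound that holds for all fixed proper colourings, up to a given level, holds for the random
colouring. -/
theorem IsRandomEnvironment.lintegral_le [IsProbabilityMeasure P] [IsProbabilityMeasure P']
    (henv : IsRandomEnvironment P P' ξ α c ζ) (hξ : ∀ i j, Measurable (ξ i j)) (N : ℕ)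
    (X : Ω → ℝ≥0∞) (B : ℝ≥0∞)
    (h : ∀ (Q : Measure Ω) (κ : Vertex b → Fin b), IsProper κ → κ [] = α →
      IsQuenched Q (logLaw P' ξ) κ (logLabel ζ) N → ∫⁻ ω, X ω ∂Q ≤ B) :
    ∫⁻ ω, X ω ∂P ≤ B := by
  let G : (wordsLT b (N + 1) → Fin b) → Set Ω := fun g => {ω | ∀ v, c ω v.1 = g v}
  have hGagree : ∀ g, ∀ ω ∈ G g, G g = agreeUpTo c (c ω) N := by
    intro g ω hω
    ext ω'
    constructor
    · intro hω' v hv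
      have hv' := mem_wordsLT.2 (Nat.lt_succ_of_le hv)
      exact (hω' ⟨v, hv'⟩).trans (hω ⟨v, hv'⟩).symm
    · intro hω' v
      exact (hω' v.1 (Nat.le_of_lt_succ (mem_wordsLT.1 v.2))).trans (hω v)
  have hGmeas : ∀ g, MeasurableSet (G g) := by
    intro g
    rcases (G g).eq_empty_or_nonempty with h0 | ⟨ω, hω⟩
    · rw [h0]; exact MeasurableSet.empty
    · rw [hGagree g ω hω]
      exact henv.measurable_colour.comap_le _ (measurableSet_agreeUpTo c _ N)
  have hGdisj : Pairwise (Function.onFun Disjoint G) := fun g g' hgg =>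
    Set.disjoint_left.2 fun ω hg hg' => hgg (funext fun v => (hg v).symm.trans (hg' v))
  have hGU : ⋃ g, G g = Set.univ :=
    Set.eq_univ_of_forall fun ω => Set.mem_iUnion.2 ⟨fun v => c ω v.1, fun _ => rfl⟩
  have hbound : ∀ g, ∫⁻ ω in G g, X ω ∂P ≤ P (G g) * B := by
    intro g
    by_cases h0 : P (G g) = 0
    · rw [setLIntegral_measure_zero _ _ h0]
      exact zero_le
    · obtain ⟨ω, hω, hprop, hα⟩ : ∃ ω ∈ G g, IsProper (c ω) ∧ c ω [] = α := by
        by_contra! hcon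
        refine h0 (measure_mono_null (fun ω hω => ?_) (ae_iff.1 henv.ae_isProper))
        exact fun h => hcon ω hω h.1 h.2
      rw [hGagree g ω hω] at h0 ⊢
      have h1 := h _ _ hprop hα (henv.isQuenched hξ h0)
      rw [ProbabilityTheory.cond, lintegral_smul_measure, smul_eq_mul] at h1
      calc _ = P (agreeUpTo c (c ω) N) * ((P (agreeUpTo c (c ω) N))⁻¹ *
            ∫⁻ ω in agreeUpTo c (c ω) N, X ω ∂P) := by
              rw [← mul_assoc, ENNReal.mul_inv_cancel h0 (by simp), one_mul]
        _ ≤ _ := mul_le_mul_right h1 _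
  calc ∫⁻ ω, X ω ∂P = ∑ g, ∫⁻ ω in G g, X ω ∂P := by
        rw [← tsum_fintype (L := .unconditional _), ← lintegral_iUnion hGmeas hGdisj, hGU,
          Measure.restrict_univ]
    _ ≤ ∑ g, P (G g) * B := Finset.sum_le_sum fun g _ => hbound g
    _ = B := by
        rw [← Finset.sum_mul, ← tsum_fintype (L := .unconditional _),
          ← measure_iUnion hGdisj hGmeas, hGU, measure_univ, one_mul]

lemma IsRandomEnvironment.measure_le [IsProbabilityMeasure P] [IsProbabilityMeasure P']
    (henv : IsRandomEnvironment P P' ξ α c ζ) (hξ : ∀ i j, Measurable (ξ i j)) (N : ℕ)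
    {E : Set Ω} (hE : MeasurableSet E) (B : ℝ≥0∞)
    (h : ∀ (Q : Measure Ω) (κ : Vertex b → Fin b), IsProper κ → κ [] = α →
      IsQuenched Q (logLaw P' ξ) κ (logLabel ζ) N → Q E ≤ B) : P E ≤ B := by
  have := henv.lintegral_le hξ N (E.indicator 1) B fun Q κ h1 h2 h3 => by
    rw [lintegral_indicator_one hE]
    exact h Q κ h1 h2 h3
  rwa [lintegral_indicator_one hE] at this

lemma IsRandomEnvironment.ae_label_pos [IsProbabilityMeasure P] [IsProbabilityMeasure P']
    (henv : IsRandomEnvironment P P' ξ α c ζ) (hpos : ∀ i j ω, 0 < ξ i j ω) :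
    ∀ᵐ ω ∂P, ∀ v i, 0 < ζ v i ω := by
  refine ae_all_iff.2 fun v => ae_all_iff.2 fun i => ?_
  have hlaw := henv.label_law {v} (fun _ => i) (fun _ => Set.Ioi 0) fun _ _ => measurableSet_Ioi
  have hm : MeasurableSet {ω | 0 < ζ v i ω} := henv.measurable_label v i measurableSet_Ioi
  simp only [Finset.mem_singleton, forall_eq, Set.mem_Ioi, Finset.prod_singleton, hpos,
    Set.ofPred_true, probReal_univ] at hlaw
  have h1 := integral_condExp (μ := P) (f := {ω | 0 < ζ v i ω}.indicator fun _ => (1 : ℝ))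
    henv.measurable_colour.comap_le
  rw [integral_congr_ae hlaw, integral_indicator hm, setIntegral_const, integral_const] at h1
  simp only [probReal_univ, smul_eq_mul, mul_one] at h1
  have h2 : P {ω | 0 < ζ v i ω} = 1 := by
    rw [← ENNReal.toReal_eq_one_iff]
    exact h1.symm
  exact (prob_compl_eq_zero_iff hm).2 h2

end Environment

lemma pathProduct_eq_exp {b : ℕ} {Ω : Type*} {ζ : Vertex b → Fin b → Ω → ℝ} {ω : Ω}
    (h : ∀ v i, 0 < ζ v i ω) (v : Vertex b) :
    pathProduct ζ v ω = Real.exp (pathSum (logLabel ζ) [] v ω) := by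
  induction v with
  | nil => simp [pathProduct, pathSum]
  | cons i v ih =>
    rw [pathProduct, ih, pathSum, Real.exp_add, logLabel, List.append_nil, Real.exp_log (h v i)]

/-! ### The second moment method -/

/-- Chebyshev's inequality for the number of events of a finite family that occur. -/
lemma sq_mul_measureReal_compl_le {Ω ι : Type*} [MeasurableSpace Ω] (Q : Measure Ω)
    [IsProbabilityMeasure Q] (V : Finset ι) (A : ι → Set Ω) (hA : ∀ v ∈ V, MeasurableSet (A v))
    {E : Set Ω} (hE : MeasurableSet E) (hEA : ∀ ω ∈ E, ∀ v ∈ V, ω ∉ A v) :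
    (∑ v ∈ V, Q.real (A v)) ^ 2 * Q.real E
      ≤ (∑ v ∈ V, ∑ v' ∈ V, Q.real (A v ∩ A v')) - (∑ v ∈ V, Q.real (A v)) ^ 2 := by
  set m := ∑ v ∈ V, Q.real (A v) with hm
  let X : Ω → ℝ := fun ω => ∑ v ∈ V, (A v).indicator (fun _ => (1 : ℝ)) ω
  have hi : ∀ v ∈ V, Integrable ((A v).indicator fun _ => (1 : ℝ)) Q := fun v hv =>
    (integrable_const 1).indicator (hA v hv)
  have hii : ∀ v ∈ V, ∀ v' ∈ V, Integrable ((A v ∩ A v').indicator fun _ => (1 : ℝ)) Q :=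
    fun v hv v' hv' => (integrable_const 1).indicator ((hA v hv).inter (hA v' hv'))
  have hX : Integrable X Q := integrable_finsetSum _ hi
  have hXint : ∫ ω, X ω ∂Q = m := by
    rw [integral_finsetSum _ hi, hm]
    exact Finset.sum_congr rfl fun v hv => by simp [integral_indicator (hA v hv)]
  have hX2 : ∀ ω, X ω ^ 2
      = ∑ v ∈ V, ∑ v' ∈ V, (A v ∩ A v').indicator (fun _ => (1 : ℝ)) ω := by
    intro ω
    simp only [X, sq, Finset.sum_mul_sum]
    refine Finset.sum_congr rfl fun v _ => Finset.sum_congr rfl fun v' _ => ?_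
    by_cases h : ω ∈ A v <;> by_cases h' : ω ∈ A v' <;> simp [h, h']
  have hX2i : Integrable (fun ω => X ω ^ 2) Q := by
    simp_rw [hX2]
    exact integrable_finsetSum _ fun v hv => integrable_finsetSum _ (hii v hv)
  have hX2int : ∫ ω, X ω ^ 2 ∂Q = ∑ v ∈ V, ∑ v' ∈ V, Q.real (A v ∩ A v') := by
    simp_rw [hX2]
    rw [integral_finsetSum _ fun v hv => integrable_finsetSum _ (hii v hv)]
    refine Finset.sum_congr rfl fun v hv => ?_
    rw [integral_finsetSum _ (hii v hv)]
    exact Finset.sum_congr rfl fun v' hv' => by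
      simp [integral_indicator ((hA v hv).inter (hA v' hv'))]
  have h1 : Integrable (fun ω => 2 * m * X ω) Q := hX.const_mul _
  have h2 : Integrable (fun ω => X ω ^ 2 - 2 * m * X ω) Q := hX2i.sub h1
  have hle : ∫ ω, E.indicator (fun _ => m ^ 2) ω ∂Q ≤ ∫ ω, (X ω ^ 2 - 2 * m * X ω + m ^ 2) ∂Q := by
    refine integral_mono ((integrable_const _).indicator hE)
      (h2.add (integrable_const _)) fun ω => ?_
    by_cases hω : ω ∈ E
    · have : X ω = 0 := Finset.sum_eq_zero fun v hv => Set.indicator_of_notMem (hEA ω hω v hv) _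
      simp [hω, this]
    · simp only [Set.indicator_of_notMem hω]
      nlinarith [sq_nonneg (X ω - m)]
  rw [integral_indicator hE, setIntegral_const, integral_add h2 (integrable_const _),
    integral_sub hX2i h1, integral_const_mul, hXint, hX2int, integral_const, probReal_univ] at hle
  simp only [smul_eq_mul, one_mul] at hle
  linarith

section SecondMoment

variable {b : ℕ} {Ω : Type*}

/-- The vertices of colour `α` at level `m + n k` all of whose ancestors at the levels
`m, m + n, …, m + n k` have colour `α`. -/
def chainVertices (κ : Vertex b → Fin b) (α : Fin b) (n m : ℕ) : ℕ → Finset (Vertex b)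
  | 0 => (words b m).filter fun v => κ v = α
  | k + 1 => ((chainVertices κ α n m k ×ˢ words b n).image fun p => p.2 ++ p.1).filter
      fun v => κ v = α

/-- The event that the path to `v` ends with `k` blocks of `n` edges on each of which the labels
have sum `> θ`. -/
def chainEvent (η : Vertex b → Fin b → Ω → ℝ) (θ : ℝ) (n : ℕ) : ℕ → Vertex b → Set Ω
  | 0, _ => Set.univ
  | k + 1, v => chainEvent η θ n k (v.drop n) ∩
      {ω | θ < pathSum η (v.drop n) (v.take n) ω}

/-- The probability of `chainEvent`. -/
def chainProb (μ : Fin b → Fin b → Measure ℝ) (κ : Vertex b → Fin b) (θ : ℝ) (n : ℕ) :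
    ℕ → Vertex b → ℝ
  | 0, _ => 1
  | k + 1, v => chainProb μ κ θ n k (v.drop n) *
      (pathLaw μ κ (v.drop n) (v.take n)).real (Set.Ioi θ)

/-- An upper bound for the probability that the chain events of `v` and `v'` both occur. In the
block in which the paths to `v` and `v'` separate only the path to `v` is taken into account, as
the labels of sibling edges may be dependent. -/
def pairBound (μ : Fin b → Fin b → Measure ℝ) (κ : Vertex b → Fin b) (θ : ℝ) (n : ℕ) :
    ℕ → Vertex b → Vertex b → ℝ
  | 0, _, _ => 1
  | k + 1, v, v' =>
    if v.drop n = v'.drop n then chainProb μ κ θ n (k + 1) v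
    else pairBound μ κ θ n k (v.drop n) (v'.drop n) *
      (pathLaw μ κ (v.drop n) (v.take n)).real (Set.Ioi θ) *
      (pathLaw μ κ (v'.drop n) (v'.take n)).real (Set.Ioi θ)

variable {μ : Fin b → Fin b → Measure ℝ} {κ : Vertex b → Fin b} {α : Fin b}
  {η : Vertex b → Fin b → Ω → ℝ} {θ : ℝ} {n m : ℕ}

lemma length_of_mem_chainVertices {k : ℕ} {v : Vertex b} (hv : v ∈ chainVertices κ α n m k) :
    v.length = m + n * k := by
  induction k generalizing v with
  | zero => exact mem_words.1 (Finset.mem_filter.1 hv).1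
  | succ k ih =>
    obtain ⟨⟨l, w⟩, hlw, rfl⟩ := Finset.mem_image.1 (Finset.mem_filter.1 hv).1
    obtain ⟨hl, hw⟩ := Finset.mem_product.1 hlw
    rw [List.length_append, mem_words.1 hw, ih hl, mul_add, mul_one]
    omega

lemma colour_of_mem_chainVertices {k : ℕ} {v : Vertex b} (hv : v ∈ chainVertices κ α n m k) :
    κ v = α := by
  cases k <;> exact (Finset.mem_filter.1 hv).2

lemma sum_chainVertices_succ (k : ℕ) (g : Vertex b → ℝ) :
    ∑ v ∈ chainVertices κ α n m (k + 1), g v = ∑ l ∈ chainVertices κ α n m k,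
      ∑ w ∈ words b n, if κ (w ++ l) = α then g (w ++ l) else 0 := by
  rw [chainVertices, Finset.sum_filter, Finset.sum_image, Finset.sum_product]
  rintro ⟨l, w⟩ h ⟨l', w'⟩ h' hlw
  have hw := mem_words.1 (Finset.mem_product.1 h).2
  have hw' := mem_words.1 (Finset.mem_product.1 h').2
  obtain ⟨h1, h2⟩ := List.append_inj hlw (hw.trans hw'.symm)
  exact Prod.ext h2 h1

lemma chainProb_nonneg (k : ℕ) (v : Vertex b) : 0 ≤ chainProb μ κ θ n k v := by
  induction k generalizing v with
  | zero => exact zero_le_one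
  | succ k ih => exact mul_nonneg (ih _) measureReal_nonneg

lemma pairBound_nonneg (k : ℕ) (v v' : Vertex b) : 0 ≤ pairBound μ κ θ n k v v' := by
  induction k generalizing v v' with
  | zero => exact zero_le_one
  | succ k ih =>
    rw [pairBound]
    split_ifs
    · exact chainProb_nonneg _ _
    · exact mul_nonneg (mul_nonneg (ih _ _) measureReal_nonneg) measureReal_nonneg

/-- A chain event contains the event that the part of the path below level `m` has sum at least
`k θ`. -/
lemma exists_of_mem_chainEvent {k : ℕ} {v : Vertex b} (hv : v.length = m + n * k) {ω : Ω}
    (hω : ω ∈ chainEvent η θ n k v) :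
    ∃ u ∈ words b m, ∃ w ∈ words b (n * k), (k : ℝ) * θ ≤ pathSum η u w ω := by
  suffices h : ∃ u w : Vertex b, v = w ++ u ∧ u.length = m ∧ w.length = n * k ∧
      (k : ℝ) * θ ≤ pathSum η u w ω by
    obtain ⟨u, w, -, hu, hw, h⟩ := h
    exact ⟨u, mem_words.2 hu, w, mem_words.2 hw, h⟩
  induction k generalizing v with
  | zero => exact ⟨v, [], by simp, by simpa using hv, by simp, by simp [pathSum]⟩
  | succ k ih =>
    obtain ⟨u, w, hvw, hu, hw, hle⟩ := ih (v := v.drop n)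
      (by rw [List.length_drop, hv, mul_add]; omega) hω.1
    refine ⟨u, v.take n ++ w, ?_, hu, ?_, ?_⟩
    · rw [List.append_assoc, ← hvw, List.take_append_drop]
    · rw [List.length_append, hw, List.length_take, hv, mul_add, mul_one]
      omega
    · have h2 := hω.2
      rw [hvw, Set.mem_ofPred_eq] at h2
      rw [pathSum_append]
      push_cast
      linarith

section Sums

variable [∀ i j, IsFiniteMeasure (μ i j)]

lemma IsProper.sum_pathLaw_Ioi (hκ : IsProper κ) {l : Vertex b} (hl : κ l = α) :
    ∑ w ∈ words b n, (if κ (w ++ l) = α then (pathLaw μ κ l w).real (Set.Ioi θ) else 0)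
      = (pathMeasure μ n α α).real (Set.Ioi θ) := by
  have h3 : ∀ w, IsFiniteMeasure (if κ (w ++ l) = α then pathLaw μ κ l w else 0) :=
    fun w => by split_ifs <;> infer_instance
  have h := hκ.sum_pathLaw μ l n α
  rw [hl] at h
  rw [← h, Measure.real, Measure.finsetSum_apply, ENNReal.toReal_sum fun w _ => by simp]
  refine Finset.sum_congr rfl fun w _ => ?_
  split_ifs <;> simp [Measure.real]

lemma take_drop_append {w l : Vertex b} (hw : w ∈ words b n) :
    (w ++ l).take n = w ∧ (w ++ l).drop n = l := by
  rw [← mem_words.1 hw]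
  exact ⟨List.take_left, List.drop_left⟩

lemma IsProper.sum_chainProb (hκ : IsProper κ) (k : ℕ) :
    ∑ v ∈ chainVertices κ α n m k, chainProb μ κ θ n k v
      = (chainVertices κ α n m 0).card * (pathMeasure μ n α α).real (Set.Ioi θ) ^ k := by
  induction k with
  | zero => simp [chainProb]
  | succ k ih =>
    rw [sum_chainVertices_succ, pow_succ, ← mul_assoc, ← ih, Finset.sum_mul]
    refine Finset.sum_congr rfl fun l hl => ?_
    rw [← hκ.sum_pathLaw_Ioi (colour_of_mem_chainVertices hl), Finset.mul_sum]
    refine Finset.sum_congr rfl fun w hw => ?_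
    obtain ⟨h1, h2⟩ := take_drop_append (l := l) hw
    rw [chainProb, h1, h2, mul_ite, mul_zero]

lemma IsProper.sum_pairBound_succ_le (hκ : IsProper κ) (k : ℕ) :
    ∑ v ∈ chainVertices κ α n m (k + 1), ∑ v' ∈ chainVertices κ α n m (k + 1),
        pairBound μ κ θ n (k + 1) v v'
      ≤ (pathMeasure μ n α α).real (Set.Ioi θ) ^ 2 *
          (∑ v ∈ chainVertices κ α n m k, ∑ v' ∈ chainVertices κ α n m k,
            pairBound μ κ θ n k v v')
        + (b : ℝ) ^ n * ((chainVertices κ α n m 0).card *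
          (pathMeasure μ n α α).real (Set.Ioi θ) ^ (k + 1)) := by
  set K := (pathMeasure μ n α α).real (Set.Ioi θ) with hK
  let q : Vertex b → Vertex b → ℝ := fun l w =>
    if κ (w ++ l) = α then (pathLaw μ κ l w).real (Set.Ioi θ) else 0
  have hq0 : ∀ l w, 0 ≤ q l w := fun l w => by
    simp only [q]; split_ifs <;> simp
  have hqK : ∀ l ∈ chainVertices κ α n m k, ∑ w ∈ words b n, q l w = K := fun l hl =>
    hκ.sum_pathLaw_Ioi (colour_of_mem_chainVertices hl)
  have hterm : ∀ l, ∀ w ∈ words b n, ∀ l', ∀ w' ∈ words b n,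
      (if κ (w ++ l) = α then (if κ (w' ++ l') = α then
        pairBound μ κ θ n (k + 1) (w ++ l) (w' ++ l') else 0) else 0)
      ≤ pairBound μ κ θ n k l l' * (q l w * q l' w')
        + if l = l' then chainProb μ κ θ n k l * q l w else 0 := by
    intro l w hw l' w' hw'
    obtain ⟨h1, h2⟩ := take_drop_append (l := l) hw
    obtain ⟨h1', h2'⟩ := take_drop_append (l := l') hw'
    have hp := pairBound_nonneg (μ := μ) (κ := κ) (θ := θ) (n := n) k l l'
    have hc := chainProb_nonneg (μ := μ) (κ := κ) (θ := θ) (n := n) k l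
    by_cases hcol : κ (w ++ l) = α
    · by_cases hcol' : κ (w' ++ l') = α
      · rw [if_pos hcol, if_pos hcol', pairBound, h2, h2', h1, h1']
        by_cases hll : l = l'
        · rw [if_pos hll, if_pos hll, chainProb, h1, h2]
          simp only [q, if_pos hcol]
          have := mul_nonneg hp (mul_nonneg (hq0 l w) (hq0 l' w'))
          simp only [q, if_pos hcol] at this
          linarith
        · rw [if_neg hll, if_neg hll]
          simp only [q, if_pos hcol, if_pos hcol']
          linarith
      · rw [if_pos hcol, if_neg hcol']
        have := mul_nonneg hp (mul_nonneg (hq0 l w) (hq0 l' w'))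
        have := mul_nonneg hc (hq0 l w)
        split_ifs <;> linarith
    · rw [if_neg hcol]
      have := mul_nonneg hp (mul_nonneg (hq0 l w) (hq0 l' w'))
      have := mul_nonneg hc (hq0 l w)
      split_ifs <;> linarith
  rw [sum_chainVertices_succ]
  calc _ = ∑ l ∈ chainVertices κ α n m k, ∑ w ∈ words b n,
          ∑ l' ∈ chainVertices κ α n m k, ∑ w' ∈ words b n,
          (if κ (w ++ l) = α then (if κ (w' ++ l') = α then
            pairBound μ κ θ n (k + 1) (w ++ l) (w' ++ l') else 0) else 0) := by
        refine Finset.sum_congr rfl fun l _ => Finset.sum_congr rfl fun w _ => ?_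
        rw [sum_chainVertices_succ]
        split_ifs <;> simp
    _ ≤ ∑ l ∈ chainVertices κ α n m k, ∑ w ∈ words b n,
          ∑ l' ∈ chainVertices κ α n m k, ∑ w' ∈ words b n,
          (pairBound μ κ θ n k l l' * (q l w * q l' w')
            + if l = l' then chainProb μ κ θ n k l * q l w else 0) :=
        Finset.sum_le_sum fun l _ => Finset.sum_le_sum fun w hw => Finset.sum_le_sum fun l' _ =>
          Finset.sum_le_sum fun w' hw' => hterm l w hw l' w' hw'
    _ = ∑ l ∈ chainVertices κ α n m k, ∑ l' ∈ chainVertices κ α n m k,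
          pairBound μ κ θ n k l l' * (K * K)
        + ∑ l ∈ chainVertices κ α n m k, (b : ℝ) ^ n * (chainProb μ κ θ n k l * K) := by
        rw [← Finset.sum_add_distrib]
        refine Finset.sum_congr rfl fun l hl => ?_
        simp only [Finset.sum_add_distrib]
        congr 1
        · rw [Finset.sum_comm]
          refine Finset.sum_congr rfl fun l' hl' => ?_
          simp only [← Finset.mul_sum]
          rw [hqK l' hl', ← Finset.sum_mul, hqK l hl]
        · have : ∀ w ∈ words b n, ∑ l' ∈ chainVertices κ α n m k, ∑ w' ∈ words b n,
              (if l = l' then chainProb μ κ θ n k l * q l w else 0)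
              = (b : ℝ) ^ n * (chainProb μ κ θ n k l * q l w) := by
            intro w _
            simp [hl, card_words]
          rw [Finset.sum_congr rfl this, ← Finset.mul_sum, ← Finset.mul_sum, hqK l hl]
    _ = _ := by
        rw [← Finset.mul_sum, ← Finset.sum_mul, hκ.sum_chainProb]
        simp only [← Finset.sum_mul]
        ring

/-- As `K > 1`, the pairs that separate early dominate the second moment. -/
lemma IsProper.sum_pairBound_le (hκ : IsProper κ)
    (hK : 1 < (pathMeasure μ n α α).real (Set.Ioi θ)) (k : ℕ) :
    ∑ v ∈ chainVertices κ α n m k, ∑ v' ∈ chainVertices κ α n m k, pairBound μ κ θ n k v v'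
      ≤ (∑ v ∈ chainVertices κ α n m k, chainProb μ κ θ n k v) ^ 2
        + (pathMeasure μ n α α).real (Set.Ioi θ) ^ (2 * k) * ((chainVertices κ α n m 0).card *
          ((b : ℝ) ^ n / ((pathMeasure μ n α α).real (Set.Ioi θ) - 1))) := by
  rw [hκ.sum_chainProb]
  set K := (pathMeasure μ n α α).real (Set.Ioi θ)
  set L : ℝ := ((chainVertices κ α n m 0).card : ℝ)
  set C := (b : ℝ) ^ n / (K - 1) with hC
  have hC0 : 0 ≤ C := div_nonneg (by positivity) (by linarith)
  have hCK : C * (K - 1) = (b : ℝ) ^ n := div_mul_cancel₀ _ (by linarith)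
  have hL : 0 ≤ L := Nat.cast_nonneg _
  have hmain : ∀ k, ∑ v ∈ chainVertices κ α n m k, ∑ v' ∈ chainVertices κ α n m k,
      pairBound μ κ θ n k v v' + C * L * K ^ k ≤ K ^ (2 * k) * (L ^ 2 + L * C) := by
    intro k
    induction k with
    | zero =>
      simp only [pairBound, Finset.sum_const, nsmul_eq_mul, mul_one, pow_zero, mul_zero, one_mul]
      simp only [L]
      linarith
    | succ k ih =>
      have h1 := hκ.sum_pairBound_succ_le (μ := μ) (θ := θ) (α := α) (n := n) (m := m) k
      have h2 := mul_le_mul_of_nonneg_left ih (sq_nonneg K)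
      have h3 : (b : ℝ) ^ n * (L * K ^ (k + 1)) + C * L * K ^ (k + 1)
          = K ^ 2 * (C * L * K ^ k) := by
        rw [← hCK]; ring
      have h4 : K ^ (2 * (k + 1)) * (L ^ 2 + L * C)
          = K ^ 2 * (K ^ (2 * k) * (L ^ 2 + L * C)) := by ring
      rw [h4]
      linarith
  have h5 : 0 ≤ C * L * K ^ k := by positivity
  have h6 : K ^ (2 * k) * (L ^ 2 + L * C) = (L * K ^ k) ^ 2 + K ^ (2 * k) * (L * C) := by ring
  linarith [hmain k]

end Sums

variable [MeasurableSpace Ω] {Q : Measure Ω} {N : ℕ}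

lemma measurableSet_chainEvent (hη : ∀ v i, Measurable (η v i)) (k : ℕ) (v : Vertex b) :
    MeasurableSet (chainEvent η θ n k v) := by
  induction k generalizing v with
  | zero => exact MeasurableSet.univ
  | succ k ih =>
    exact (ih _).inter (measurableSet_lt measurable_const (measurable_pathSum hη _ _))

/-- The sum along a path below `l` is independent of labels of edges that do not lie below `l`,
provided that only one edge is selected at each parent. -/
lemma IsQuenched.exists_extend (hQ : IsQuenched Q μ κ η N) {f : Vertex b → Fin b}
    {T : Set (Vertex b)} {D : Set Ω} (hD : MeasurableSet[edgeSigma η f T] D)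
    (hT : ∀ u ∈ T, u.length < N) {l w : Vertex b} (hl : ∀ u ∈ T, ¬ l <:+ u)
    (hN : w.length + l.length ≤ N) :
    ∃ g, MeasurableSet[edgeSigma η g (T ∪ {u | l <:+ u ∧ u.length < w.length + l.length})]
        (D ∩ {ω | θ < pathSum η l w ω}) ∧
      Q.real (D ∩ {ω | θ < pathSum η l w ω}) = Q.real D * (pathLaw μ κ l w).real (Set.Ioi θ) := by
  obtain ⟨g, hg, hgf⟩ := exists_follows f l w
  have hDg : MeasurableSet[edgeSigma η g T] D :=
    edgeSigma_mono η le_rfl (fun u hu => (hgf u (hl u hu)).symm) _ hD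
  have hB : MeasurableSet[edgeSigma η g {u | l <:+ u ∧ u.length < w.length + l.length}]
      {ω | θ < pathSum η l w ω} :=
    measurable_pathSum_edgeSigma η hg measurableSet_Ioi
  refine ⟨g, MeasurableSet.inter (edgeSigma_mono η Set.subset_union_left (fun _ _ => rfl) _ hDg)
    (edgeSigma_mono η Set.subset_union_right (fun _ _ => rfl) _ hB), ?_⟩
  have hind := hQ.indep_edgeSigma g hT
    (T := {u | l <:+ u ∧ u.length < w.length + l.length}) (fun u hu => hu.2.trans_le hN)
    (Set.disjoint_left.2 fun u hu hu' => hl u hu hu'.1)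
  rw [← hQ.map_pathSum hN, map_measureReal_apply (measurable_pathSum hQ.measurable l w)
    measurableSet_Ioi, measureReal_def, measureReal_def, measureReal_def, ← ENNReal.toReal_mul]
  exact congrArg _ ((ProbabilityTheory.Indep_iff _ _ Q).1 hind _ _ hDg hB)

lemma not_suffix_of_length_lt {l u : Vertex b} (h : u.length < l.length) : ¬ l <:+ u :=
  fun h' => absurd h'.length_le (not_le.2 h)

lemma IsQuenched.chainEvent_prob (hQ : IsQuenched Q μ κ η N) {k : ℕ} {v : Vertex b}
    (hv : v.length = m + n * k) (hN : m + n * k ≤ N) :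
    ∃ f, MeasurableSet[edgeSigma η f {u | u.length < m + n * k}] (chainEvent η θ n k v) ∧
      Q.real (chainEvent η θ n k v) = chainProb μ κ θ n k v := by
  have := hQ.isProbabilityMeasure
  induction k generalizing v with
  | zero => exact ⟨κ, MeasurableSet.univ, by simp [chainEvent, chainProb]⟩
  | succ k ih =>
    have hnk : n * (k + 1) = n * k + n := by ring
    have hd : (v.drop n).length = m + n * k := by rw [List.length_drop]; omega
    have ht : (v.take n).length = n := by rw [List.length_take]; omega
    obtain ⟨f, hf, hp⟩ := ih hd (by omega)
    obtain ⟨g, hg, hgp⟩ := hQ.exists_extend (θ := θ) hf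
      (fun u hu => lt_of_lt_of_le hu (by omega)) (l := v.drop n) (w := v.take n)
      (fun u hu => not_suffix_of_length_lt (by rw [hd]; exact hu)) (by rw [hd, ht]; omega)
    refine ⟨g, edgeSigma_mono η ?_ (fun _ _ => rfl) _ hg, ?_⟩
    · rintro u (hu | ⟨-, hu⟩)
      · exact (show u.length < m + n * k from hu).trans_le (by omega)
      · rw [hd, ht] at hu
        exact lt_of_lt_of_le hu (by omega)
    · rw [chainEvent, hgp, hp, chainProb]

lemma IsQuenched.exists_pairBound (hQ : IsQuenched Q μ κ η N) {k : ℕ} {v v' : Vertex b}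
    (hv : v.length = m + n * k) (hv' : v'.length = m + n * k) (hN : m + n * k ≤ N) :
    ∃ f D, MeasurableSet[edgeSigma η f {u | u.length < m + n * k}] D ∧
      chainEvent η θ n k v ∩ chainEvent η θ n k v' ⊆ D ∧
      Q.real D = pairBound μ κ θ n k v v' := by
  have := hQ.isProbabilityMeasure
  induction k generalizing v v' with
  | zero => exact ⟨κ, Set.univ, MeasurableSet.univ, Set.subset_univ _, by simp [pairBound]⟩
  | succ k ih =>
    by_cases hvv : v.drop n = v'.drop n
    · obtain ⟨f, hf, hp⟩ := hQ.chainEvent_prob (θ := θ) hv hN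
      exact ⟨f, _, hf, Set.inter_subset_left, by rw [pairBound, if_pos hvv, hp]⟩
    have hnk : n * (k + 1) = n * k + n := by ring
    have hd : (v.drop n).length = m + n * k := by rw [List.length_drop]; omega
    have ht : (v.take n).length = n := by rw [List.length_take]; omega
    have hd' : (v'.drop n).length = m + n * k := by rw [List.length_drop]; omega
    have ht' : (v'.take n).length = n := by rw [List.length_take]; omega
    obtain ⟨f, D, hD, hsub, hp⟩ := ih hd hd' (by omega)
    obtain ⟨g, hg, hgp⟩ := hQ.exists_extend (θ := θ) hD
      (fun u hu => lt_of_lt_of_le hu (by omega)) (l := v.drop n) (w := v.take n)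
      (fun u hu => not_suffix_of_length_lt (by rw [hd]; exact hu)) (by rw [hd, ht]; omega)
    obtain ⟨g', hg', hgp'⟩ := hQ.exists_extend (θ := θ) hg
      (by
        rintro u (hu | ⟨-, hu⟩)
        · exact lt_of_lt_of_le hu (by omega)
        · exact lt_of_lt_of_le hu (by rw [hd, ht]; omega))
      (l := v'.drop n) (w := v'.take n)
      (by
        rintro u (hu | ⟨hu, -⟩)
        · exact not_suffix_of_length_lt (by rw [hd']; exact hu)
        · intro hu'
          exact hvv ((List.suffix_of_suffix_length_le hu hu' (by omega)).eq_of_length (by omega)))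
      (by rw [hd', ht']; omega)
    refine ⟨g', _, edgeSigma_mono η ?_ (fun _ _ => rfl) _ hg', ?_, ?_⟩
    · rintro u ((hu | ⟨-, hu⟩) | ⟨-, hu⟩)
      · exact (show u.length < m + n * k from hu).trans_le (by omega)
      · exact lt_of_lt_of_le hu (by rw [hd, ht]; omega)
      · exact lt_of_lt_of_le hu (by rw [hd', ht']; omega)
    · rintro ω ⟨⟨h1, h2⟩, ⟨h1', h2'⟩⟩
      exact ⟨⟨hsub ⟨h1, h1'⟩, h2⟩, h2'⟩
    · rw [hgp', hgp, hp, pairBound, if_neg hvv]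

lemma IsProper.card_chainVertices_zero (hκ : IsProper κ) :
    (chainVertices κ α n (m + 1) 0).card = b ^ m := by
  rw [chainVertices, Finset.card_filter, sum_words_succ,
    Finset.sum_congr rfl fun w _ => hκ.sum_children w fun c => if c = α then 1 else 0]
  simp [card_words]

/-- With `K > 1` the expected number of descendants of colour `α`, `n` levels below a vertex of
colour `α`, with relative sum `> θ`, the `b ^ m` vertices of colour `α` at level `m + 1` all fail
to have a long chain of blocks with sum `> θ` with probability `O(b ^ (-m))` only, uniformly in
the length of the chain. -/
theorem IsQuenched.measureReal_compl_le [∀ i j, IsFiniteMeasure (μ i j)]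
    (hQ : IsQuenched Q μ κ η N) (hκ : IsProper κ)
    (hK : 1 < (pathMeasure μ n α α).real (Set.Ioi θ)) {k : ℕ} (hN : m + 1 + n * k ≤ N)
    {E : Set Ω} (hE : MeasurableSet E)
    (hEk : ∀ ω ∈ E, ∀ u ∈ words b (m + 1), ∀ w ∈ words b (n * k),
      pathSum η u w ω < (k : ℝ) * θ) :
    Q.real E ≤ (b : ℝ) ^ n / ((pathMeasure μ n α α).real (Set.Ioi θ) - 1) / (b : ℝ) ^ m := by
  have := hQ.isProbabilityMeasure
  have hprob : ∀ v ∈ chainVertices κ α n (m + 1) k,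
      Q.real (chainEvent η θ n k v) = chainProb μ κ θ n k v := fun v hv =>
    (hQ.chainEvent_prob (length_of_mem_chainVertices hv) hN).choose_spec.2
  have h1 := sq_mul_measureReal_compl_le Q (chainVertices κ α n (m + 1) k)
    (chainEvent η θ n k) (fun v _ => measurableSet_chainEvent hQ.measurable k v) hE
    (fun ω hω v hv hωv => by
      obtain ⟨u, hu, w, hw, h⟩ := exists_of_mem_chainEvent (length_of_mem_chainVertices hv) hωv
      exact absurd h (not_le.2 (hEk ω hω u hu w hw)))
  have h2 : ∑ v ∈ chainVertices κ α n (m + 1) k, ∑ v' ∈ chainVertices κ α n (m + 1) k,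
      Q.real (chainEvent η θ n k v ∩ chainEvent η θ n k v')
      ≤ ∑ v ∈ chainVertices κ α n (m + 1) k, ∑ v' ∈ chainVertices κ α n (m + 1) k,
        pairBound μ κ θ n k v v' := by
    refine Finset.sum_le_sum fun v hv => Finset.sum_le_sum fun v' hv' => ?_
    obtain ⟨f, D, -, hsub, hD⟩ := hQ.exists_pairBound (θ := θ) (length_of_mem_chainVertices hv)
      (length_of_mem_chainVertices hv') hN
    rw [← hD]
    exact measureReal_mono hsub
  have h3 := hκ.sum_pairBound_le (μ := μ) (m := m + 1) hK k
  rw [Finset.sum_congr rfl hprob] at h1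
  have h4 := h1.trans (sub_le_sub_right (h2.trans h3) _)
  rw [add_sub_cancel_left, hκ.sum_chainProb, hκ.card_chainVertices_zero] at h4
  set K := (pathMeasure μ n α α).real (Set.Ioi θ)
  have hb : 0 < b := α.pos
  have hbm : (0 : ℝ) < (b : ℝ) ^ m := by positivity
  have hKk : 0 < K ^ (2 * k) := by positivity
  push_cast at h4
  rw [le_div_iff₀ hbm]
  have h5 : (K ^ (2 * k) * (b : ℝ) ^ m) * (Q.real E * (b : ℝ) ^ m)
      ≤ (K ^ (2 * k) * (b : ℝ) ^ m) * ((b : ℝ) ^ n / (K - 1)) := by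
    calc _ = ((b : ℝ) ^ m * K ^ k) ^ 2 * Q.real E := by ring
      _ ≤ _ := h4
      _ = _ := by ring
  exact le_of_mul_le_mul_left h5 (by positivity)

end SecondMoment

/-! ### The two regimes -/

/-- Long chains of blocks below a fixed level produce infinitely many vertices with a large
product of labels. -/
lemma Z_eq_top_of_frequently {b : ℕ} {Ω : Type*} {ζ : Vertex b → Fin b → Ω → ℝ} {ω : Ω}
    (hζ : ∀ v i, 0 < ζ v i ω) {n m : ℕ} (hn : n ≠ 0) {θ : ℝ} (hθ : 0 < θ)
    (h : ∃ᶠ k : ℕ in atTop, ∃ u ∈ words b m, ∃ w ∈ words b (n * k),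
      (k : ℝ) * θ ≤ pathSum (logLabel ζ) u w ω) {x : ℝ} (hx : 0 < x) : Z ζ x ω = ⊤ := by
  rw [Z, Set.encard_eq_top_iff]
  intro hfin
  obtain ⟨B, hB⟩ := (hfin.image List.length).bddAbove
  obtain ⟨C, hC⟩ := ((words b m).finite_toSet.image
    fun u => -pathSum (logLabel ζ) [] u ω).bddAbove
  have hlim : Tendsto (fun k : ℕ => (k : ℝ) * θ) atTop atTop :=
    tendsto_natCast_atTop_atTop.atTop_mul_const hθ
  obtain ⟨k, ⟨u, hu, w, hw, hle⟩, hk1, hk2⟩ := (h.and_eventually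
    ((hlim.eventually_gt_atTop (C + Real.log x)).and (eventually_gt_atTop B))).exists
  have hCu : -pathSum (logLabel ζ) [] u ω ≤ C := hC (Set.mem_image_of_mem _ hu)
  have hmem : w ++ u ∈ {v : Vertex b | x < pathProduct ζ v ω} := by
    rw [Set.mem_ofPred_eq, pathProduct_eq_exp hζ, pathSum_append, List.append_nil,
      ← Real.log_lt_iff_lt_exp hx]
    linarith
  have hlen := hB (Set.mem_image_of_mem _ hmem)
  rw [List.length_append, mem_words.1 hw] at hlen
  have := Nat.le_mul_of_pos_left k (Nat.pos_of_ne_zero hn)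
  omega

section Regimes

variable {b : ℕ} {Ω Ω' : Type*} [MeasurableSpace Ω] [MeasurableSpace Ω'] {P : Measure Ω}
  {P' : Measure Ω'} {ξ : Fin b → Fin b → Ω' → ℝ} {α : Fin b} {c : Ω → Vertex b → Fin b}
  {ζ : Vertex b → Fin b → Ω → ℝ}

lemma laplace_logLaw (hξ : ∀ i j, Measurable (ξ i j)) (hpos : ∀ i j ω, 0 < ξ i j ω)
    (s : ℝ) (i j : Fin b) :
    laplace s (logLaw P' ξ i j) = ∫⁻ ω, ENNReal.ofReal (ξ i j ω ^ s) ∂P' := by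
  rw [logLaw, laplace_map (f := fun ω => Real.log (ξ i j ω)) s P'
    (Real.measurable_log.comp (hξ i j))]
  refine lintegral_congr fun ω => ?_
  rw [Real.rpow_def_of_pos (hpos i j ω), mul_comm]

lemma laplace_logLaw_of_mem (hξ : ∀ i j, Measurable (ξ i j))
    (hpos : ∀ i j ω, 0 < ξ i j ω) {s : ℝ} (hs : s ∈ momentDomain P' ξ) (i j : Fin b) :
    laplace s (logLaw P' ξ i j) = ENNReal.ofReal (momentMatrix P' ξ s i j) := by
  rw [laplace_logLaw hξ hpos, momentMatrix, Matrix.of_apply, ofReal_integral_eq_lintegral_ofReal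
    (hs i j) (Eventually.of_forall fun ω => (Real.rpow_pos_of_pos (hpos i j ω) s).le)]

lemma logLaw_ne_zero [IsProbabilityMeasure P'] (hξ : ∀ i j, Measurable (ξ i j))
    (i j : Fin b) : logLaw P' ξ i j ≠ 0 := by
  have : IsProbabilityMeasure (logLaw P' ξ i j) :=
    Measure.isProbabilityMeasure_map (Real.measurable_log.comp (hξ i j)).aemeasurable
  exact IsProbabilityMeasure.ne_zero _

lemma momentMatrix_pos [IsProbabilityMeasure P'] (hξ : ∀ i j, Measurable (ξ i j))
    (hpos : ∀ i j ω, 0 < ξ i j ω) {s : ℝ} (hs : s ∈ momentDomain P' ξ)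
    (i j : Fin b) : 0 < momentMatrix P' ξ s i j := by
  have h := laplace_ne_zero s (logLaw_ne_zero (P' := P') hξ i j)
  rw [laplace_logLaw_of_mem hξ hpos hs] at h
  exact ENNReal.ofReal_pos.1 (pos_iff_ne_zero.2 h)

lemma exists_one_lt_laplace [IsProbabilityMeasure P'] (hξ : ∀ i j, Measurable (ξ i j))
    (hpos : ∀ i j ω, 0 < ξ i j ω) (hlam : 1 < lam P' ξ) {s : ℝ} (hs : 0 ≤ s)
    (i : Fin b) : ∃ n, 1 < laplace s (pathMeasure (logLaw P' ξ) n i i) := by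
  have hrho : 1 < rho P' ξ s := hlam.trans_le (iInf₂_le s hs)
  by_cases hD : s ∈ momentDomain P' ξ
  · rw [rho, if_pos hD, ← EReal.coe_one, EReal.coe_lt_coe_iff] at hrho
    set S := {r : ℝ | Module.End.HasEigenvalue (Matrix.toLin' (momentMatrix P' ξ s)) r}
    have hne : S.Nonempty := by
      by_contra hcon
      rw [Set.not_nonempty_iff_eq_empty.1 hcon, Real.sSup_empty] at hrho
      linarith
    obtain ⟨r, hr, h1r⟩ := exists_lt_of_lt_csSup hne hrho
    exact exists_one_lt_laplace_of_eigenvalue _ (momentMatrix_pos hξ hpos hD)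
      (laplace_logLaw_of_mem hξ hpos hD) h1r hr i
  · obtain ⟨k, l, hkl⟩ : ∃ k l, ¬ Integrable (fun ω => ξ k l ω ^ s) P' := by
      by_contra! hcon
      exact hD hcon
    refine exists_one_lt_laplace_of_eq_top _ (logLaw_ne_zero hξ) (k := k) (l := l) ?_ i
    rw [laplace_logLaw hξ hpos]
    by_contra hfin
    refine hkl ⟨((hξ k l).pow_const s).aestronglyMeasurable, ?_⟩
    rw [hasFiniteIntegral_iff_ofReal
      (Eventually.of_forall fun ω => (Real.rpow_pos_of_pos (hpos k l ω) s).le)]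
    exact lt_top_iff_ne_top.2 hfin

/-- The first moment of the sum of `ζ[v] ^ s` over a level is a row sum of a power of the moment
matrix. -/
lemma IsQuenched.lintegral_level_sum {μ : Fin b → Fin b → Measure ℝ}
    [∀ i j, IsFiniteMeasure (μ i j)] {Q : Measure Ω} {κ : Vertex b → Fin b}
    {η : Vertex b → Fin b → Ω → ℝ} {n : ℕ} (hQ : IsQuenched Q μ κ η n) (hκ : IsProper κ) {s : ℝ}
    {M : Matrix (Fin b) (Fin b) ℝ} (hM : ∀ i j, 0 ≤ M i j)
    (h : ∀ i j, laplace s (μ i j) = ENNReal.ofReal (M i j)) :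
    ∫⁻ ω, ∑ w ∈ words b n, ENNReal.ofReal (Real.exp (s * pathSum η [] w ω)) ∂Q
      = ENNReal.ofReal (∑ j, (M ^ n) (κ []) j) := by
  have h1 : ∀ w ∈ words b n, ∫⁻ ω, ENNReal.ofReal (Real.exp (s * pathSum η [] w ω)) ∂Q
      = ∑ j, laplace s (if κ (w ++ []) = j then pathLaw μ κ [] w else 0) := by
    intro w hw
    rw [← laplace_map s Q (measurable_pathSum hQ.measurable [] w),
      hQ.map_pathSum (by simpa using (mem_words.1 hw).le),
      Finset.sum_eq_single (κ (w ++ []))]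
    · simp
    · intro j _ hj
      rw [if_neg (Ne.symm hj), laplace, lintegral_zero_measure]
    · simp
  rw [lintegral_finsetSum _ fun w _ => by
    have := measurable_pathSum hQ.measurable ([] : Vertex b) w
    fun_prop, Finset.sum_congr rfl h1, Finset.sum_comm,
    ENNReal.ofReal_sum_of_nonneg fun j _ => pow_nonneg_apply hM n _ j]
  refine Finset.sum_congr rfl fun j _ => ?_
  rw [← laplace_finset_sum, hκ.sum_pathLaw μ, laplace_pathMeasure μ hM h]

/-- If `ρ(s) < 1` for some `s ≥ 0`, then the sum of `ζ[v] ^ s` over all vertices has finite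
expectation. -/
theorem ae_Z_lt_top [IsProbabilityMeasure P] [IsProbabilityMeasure P']
    (hξ : ∀ i j, Measurable (ξ i j)) (hpos : ∀ i j ω, 0 < ξ i j ω)
    (henv : IsRandomEnvironment P P' ξ α c ζ) (hlam : lam P' ξ < 1) {x : ℝ} (hx : 0 < x) :
    ∀ᵐ ω ∂P, Z ζ x ω < ⊤ := by
  obtain ⟨s, hs, hrho⟩ : ∃ s : ℝ, 0 ≤ s ∧ rho P' ξ s < 1 := by
    obtain ⟨s, hs⟩ := iInf_lt_iff.1 hlam
    obtain ⟨hs0, hs⟩ := iInf_lt_iff.1 hs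
    exact ⟨s, hs0, hs⟩
  have hD : s ∈ momentDomain P' ξ := by
    by_contra hD
    rw [rho, if_neg hD] at hrho
    exact not_top_lt hrho
  rw [rho, if_pos hD, ← EReal.coe_one, EReal.coe_lt_coe_iff] at hrho
  have : Nonempty (Fin b) := ⟨α⟩
  set M := momentMatrix P' ξ s
  have hM : ∀ i j, 0 < M i j := momentMatrix_pos hξ hpos hD
  have hsum : Summable fun n => ∑ j, (M ^ n) α j := summable_pow_row hM hrho
    (fun r hr => le_csSup (Module.End.finite_hasEigenvalue _).bddAbove hr) α
  have hη : ∀ v i, Measurable (logLabel ζ v i) := fun v i =>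
    Real.measurable_log.comp (henv.measurable_label v i)
  let T : ℕ → Ω → ℝ≥0∞ := fun n ω =>
    ∑ w ∈ words b n, ENNReal.ofReal (Real.exp (s * pathSum (logLabel ζ) [] w ω))
  have hTm : ∀ n, Measurable (T n) := fun n => Finset.measurable_sum _ fun w _ => by
    have := measurable_pathSum hη ([] : Vertex b) w
    fun_prop
  have hT : ∀ n, ∫⁻ ω, T n ω ∂P ≤ ENNReal.ofReal (∑ j, (M ^ n) α j) := fun n =>
    henv.lintegral_le hξ n _ _ fun Q κ hκ hα hQ => by
      have := hQ.lintegral_level_sum hκ (fun i j => (hM i j).le)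
        (laplace_logLaw_of_mem hξ hpos hD)
      rw [hα] at this
      exact this.le
  have hfin : ∫⁻ ω, ∑' n, T n ω ∂P ≠ ⊤ := by
    rw [lintegral_tsum fun n => (hTm n).aemeasurable]
    exact ne_top_of_le_ne_top hsum.tsum_ofReal_ne_top (ENNReal.tsum_le_tsum hT)
  filter_upwards [ae_lt_top (Measurable.tsum hTm) hfin, henv.ae_label_pos hpos]
    with ω hω hζ
  have hε : ENNReal.ofReal (x ^ s) ≠ 0 := by
    simpa using Real.rpow_pos_of_pos hx s
  have hlevels := ENNReal.finite_const_le_of_tsum_ne_top hω.ne hε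
  rw [Z, Set.encard_lt_top_iff]
  refine (hlevels.biUnion fun n _ => (words b n).finite_toSet).subset fun v hv => ?_
  refine Set.mem_biUnion (x := v.length) ?_ (mem_words.2 rfl)
  have h1 : ENNReal.ofReal (x ^ s) ≤
      ENNReal.ofReal (Real.exp (s * pathSum (logLabel ζ) [] v ω)) := by
    refine ENNReal.ofReal_le_ofReal ?_
    rw [mul_comm, Real.exp_mul, ← pathProduct_eq_exp hζ]
    exact Real.rpow_le_rpow hx.le (le_of_lt hv) hs
  exact h1.trans (Finset.single_le_sum (f := fun w =>
    ENNReal.ofReal (Real.exp (s * pathSum (logLabel ζ) [] w ω))) (fun _ _ => zero_le)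
    (mem_words.2 rfl))

lemma exists_pathMeasure_pos [IsProbabilityMeasure P] [IsProbabilityMeasure P']
    (hξ : ∀ i j, Measurable (ξ i j)) (hpos : ∀ i j ω, 0 < ξ i j ω)
    (henv : IsRandomEnvironment P P' ξ α c ζ)
    (hunb : ∀ C : ℝ, ∃ v : Vertex b, 0 < P {ω | C < pathProduct ζ v ω}) (T : ℝ) :
    ∃ n j, 0 < pathMeasure (logLaw P' ξ) n α j (Set.Ioi T) := by
  by_contra! hcon
  obtain ⟨v, hv⟩ := hunb (Real.exp T)
  have hη : ∀ v i, Measurable (logLabel ζ v i) := fun v i =>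
    Real.measurable_log.comp (henv.measurable_label v i)
  have h0 : P {ω | T < pathSum (logLabel ζ) [] v ω} ≤ 0 := by
    refine henv.measure_le hξ v.length
      (measurableSet_lt measurable_const (measurable_pathSum hη _ _)) 0 fun Q κ hκ hα hQ => ?_
    have h1 : Q {ω | T < pathSum (logLabel ζ) [] v ω}
        = pathLaw (logLaw P' ξ) κ [] v (Set.Ioi T) := by
      rw [← hQ.map_pathSum (by simp), Measure.map_apply (measurable_pathSum hη _ _)
        measurableSet_Ioi]
      rfl
    rw [h1]
    refine (hκ.pathLaw_le _ [] v _).trans ?_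
    rw [hα]
    exact hcon _ _
  refine hv.ne' (measure_mono_null_ae ?_ (le_antisymm h0 zero_le))
  filter_upwards [henv.ae_label_pos hpos] with ω hω h
  change Real.exp T < pathProduct ζ v ω at h
  rw [pathProduct_eq_exp hω] at h
  exact Real.exp_lt_exp.1 h

/-- If `ρ(s) > 1` for all `s ≥ 0` and the products are unbounded, there are almost surely
infinitely many vertices with a large product. -/
theorem ae_Z_eq_top (hb : 2 ≤ b) [IsProbabilityMeasure P] [IsProbabilityMeasure P']
    (hξ : ∀ i j, Measurable (ξ i j)) (hpos : ∀ i j ω, 0 < ξ i j ω)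
    (henv : IsRandomEnvironment P P' ξ α c ζ) (hlam : 1 < lam P' ξ)
    (hunb : ∀ C : ℝ, ∃ v : Vertex b, 0 < P {ω | C < pathProduct ζ v ω}) {x : ℝ} (hx : 0 < x) :
    ∀ᵐ ω ∂P, Z ζ x ω = ⊤ := by
  obtain ⟨n, θ, hθ, hK⟩ := exists_one_lt_pathMeasure (logLaw P' ξ) α
    (fun s hs => exists_one_lt_laplace hξ hpos hlam hs α)
    (exists_pos_pathMeasure _ (logLaw_ne_zero hξ) α
      (exists_pathMeasure_pos hξ hpos henv hunb))
  have hn : n ≠ 0 := by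
    rintro rfl
    simp [pathMeasure, hθ.le] at hK
  have hK' : 1 < (pathMeasure (logLaw P' ξ) n α α).real (Set.Ioi θ) := by
    rw [measureReal_def, ← ENNReal.toReal_one]
    exact (ENNReal.toReal_lt_toReal (by simp) (by simp)).2 hK
  have hη : ∀ v i, Measurable (logLabel ζ v i) := fun v i =>
    Real.measurable_log.comp (henv.measurable_label v i)
  set B := (b : ℝ) ^ n / ((pathMeasure (logLaw P' ξ) n α α).real (Set.Ioi θ) - 1)
  let F : ℕ → ℕ → Set Ω := fun m k => {ω | ∀ u ∈ words b (m + 1), ∀ w ∈ words b (n * k),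
    pathSum (logLabel ζ) u w ω < (k : ℝ) * θ}
  have hF : ∀ m k, MeasurableSet (F m k) := by
    intro m k
    have : F m k = ⋂ u ∈ words b (m + 1), ⋂ w ∈ words b (n * k),
        {ω | pathSum (logLabel ζ) u w ω < (k : ℝ) * θ} := by
      ext ω; simp [F]
    rw [this]
    exact Finset.measurableSet_biInter _ fun u _ => Finset.measurableSet_biInter _ fun w _ =>
      measurableSet_lt (measurable_pathSum hη _ _) measurable_const
  have hFP : ∀ m k, P (F m k) ≤ ENNReal.ofReal (B / (b : ℝ) ^ m) := by
    intro m k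
    refine henv.measure_le hξ (m + 1 + n * k) (hF m k) _ fun Q κ hκ hα hQ => ?_
    have := hQ.isProbabilityMeasure
    rw [← ofReal_measureReal]
    exact ENNReal.ofReal_le_ofReal
      (hQ.measureReal_compl_le hκ hK' le_rfl (hF m k) fun ω hω => hω)
  have hN : ∀ m, P {ω | ∀ᶠ k in atTop, ω ∈ F m k} ≤ ENNReal.ofReal (B / (b : ℝ) ^ m) := by
    intro m
    have hset : {ω | ∀ᶠ k in atTop, ω ∈ F m k} = ⋃ j, ⋂ k, ⋂ _ : j ≤ k, F m k := by
      ext ω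
      simp [eventually_atTop]
    have hmono : Monotone fun j => ⋂ k, ⋂ _ : j ≤ k, F m k := fun j j' hjj =>
      Set.iInter_mono fun k => Set.iInter_mono' fun hk => ⟨hjj.trans hk, le_rfl⟩
    rw [hset, hmono.measure_iUnion]
    exact iSup_le fun j => (measure_mono (Set.iInter₂_subset j le_rfl)).trans (hFP m j)
  have hlim : Tendsto (fun m : ℕ => ENNReal.ofReal (B / (b : ℝ) ^ m)) atTop (𝓝 0) := by
    have hb' : (1 : ℝ) < b := by exact_mod_cast hb
    rw [← ENNReal.ofReal_zero]
    exact ENNReal.tendsto_ofReal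
      ((tendsto_pow_atTop_atTop_of_one_lt hb').const_div_atTop B)
  have hnull : P (⋂ m, {ω | ∀ᶠ k in atTop, ω ∈ F m k}) = 0 := by
    refine le_antisymm (ge_of_tendsto' hlim fun m => ?_) zero_le
    exact (measure_mono (Set.iInter_subset _ m)).trans (hN m)
  filter_upwards [compl_mem_ae_iff.2 hnull, henv.ae_label_pos hpos] with ω hω hζ
  obtain ⟨m, hm⟩ := not_forall.1 fun h => hω (Set.mem_iInter.2 h)
  refine Z_eq_top_of_frequently hζ (m := m + 1) hn hθ ?_ hx
  refine (not_eventually.1 hm).mono fun k hk => ?_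
  by_contra! hcon
  exact hk hcon

end Regimes

end ColouredTree

end

theorem theorem2 {b : ℕ} (hb : 2 ≤ b)
    {Ω' : Type*} [MeasurableSpace Ω'] (P' : Measure Ω') [IsProbabilityMeasure P']
    (ξ : Fin b → Fin b → Ω' → ℝ) (hξ : ∀ i j, Measurable (ξ i j)) (hpos : ∀ i j ω, 0 < ξ i j ω)
    (hreg : ColouredTree.Regular P' ξ)
    {Ω : Type*} [MeasurableSpace Ω] (P : Measure Ω) [IsProbabilityMeasure P]
    (α : Fin b) (c : Ω → ColouredTree.Vertex b → Fin b)
    (ζ : ColouredTree.Vertex b → Fin b → Ω → ℝ)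
    (henv : ColouredTree.IsRandomEnvironment P P' ξ α c ζ) :
    (ColouredTree.lam P' ξ < 1 →
      ∀ x : ℝ, 0 < x → ∀ᵐ ω ∂P, ColouredTree.Z ζ x ω < ⊤) ∧
    (1 < ColouredTree.lam P' ξ →
      (∀ C : ℝ, ∃ v : ColouredTree.Vertex b, 0 < P {ω | C < ColouredTree.pathProduct ζ v ω}) →
      ∀ x : ℝ, 0 < x → ∀ᵐ ω ∂P, ColouredTree.Z ζ x ω = ⊤) :=
  ⟨fun h _ hx => ColouredTree.ae_Z_lt_top hξ hpos henv h hx,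
    fun h h' _ hx => ColouredTree.ae_Z_eq_top hb hξ hpos henv h h' hx⟩
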